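/- **Setting.** Let $\mathcal X=\mathbb R^{d\times r}$ with the Frobenius norm, $\mathcal Y=\mathbb R^{m}$ with the Euclidean norm, and let $\mathcal M=\{x\in\mathcal X: x^\top x=I_r\}$ be the Stiefel manifold. Put $c(x)=x^\top x-I_r$ and $A(x)=x(\tfrac32 I_r-\tfrac12x^\top x)$. Consider $\min_{x\in\mathcal M}\max_{y\in\mathcal Y} f_r(x,y)$, $f_r(x,y)=f(x,y)-h(y)$, and fix $C>\tfrac12+\sup_{x\in\mathcal M}\|x\|$, $X=\{x:\|x\|\le C\}$, $\bar X=A(X)$. Assume: 1. $h:\mathcal Y\to\mathbb R\cup\{+\infty\}$ is proper, closed and $\zeta$-weakly convex ($\zeta\ge0$, i.e. $h+\frac\zeta2\|\cdot\|^2$ is convex), its domain $Y=\operatorname{dom}h$ is closed and bounded, and $h$ is locally Lipschitz on $Y$. 2. $f:\mathcal X\times\mathcal Y\to\mathbb R$ is differentiable on an open set containing $\bar X\times Y$, and for all $x_1,x_2\in\bar X$, $y_1,y_2\in Y$, $\|\nabla_xf(x_1,y_1)-\nabla_xf(x_2,y_2)\|\le L_{xx}\|x_1-x_2\|+L_{xy}\|y_1-y_2\|$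 and $\|\nabla_yf(x_1,y_1)-\nabla_yf(x_2,y_2)\|\le L_{yx}\|x_1-x_2\|+L_{yy}\|y_1-y_2\|$. 3. For some $\mu>0$, with $F(x)=\max_{w\in Y} f_r(x,w)$ and $\partial h$ the Fréchet subdifferential, $2\mu\,(F(x)-f_r(x,y))\le\operatorname{dist}^2\big(0,-\nabla_yf(x,y)+\partial h(y)\big)$ for all $x\in\bar X$, $y\in Y$ (where $\operatorname{dist}(0,\emptyset)=\infty$). For $\rho>0$ let $\tilde f(x,y)=f(A(x),y)+\frac\rho4\|c(x)\|^2$, and let $l>0$ be such that for all $x_1,x_2\in X$ and $y_1,y_2\in Y$ both $\|\nabla_x\tilde f(x_1,y_1)-\nabla_x\tilde f(x_2,y_2)\|$ and $\|\nabla_y\tilde f(x_1,y_1)-\nabla_y\tilde f(x_2,y_2)\|$ are at most $l\|x_1-x_2\|+l\|y_1-y_2\|$. Put $\bar\kappa=\max\{1,l/\mu\}$, $\bar F=\min_{x\in X}F(A(x))$, $p=2l$, $\hat f(x,y;z)=\tilde f(x,y)+\frac p2\|x-z\|^2$, $x^*(z)=\operatorname{argmin}_{x\in X}\max_{y\in Y}\{\hat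 f(x,y;z)-h(y)\}$ and $Y^*(z)=\operatorname{argmax}_{y\in Y}\{\min_{x\in X}\hat f(x,y;z)-h(y)\}$. **Algorithm (sm-MGDA).** Given $\tau_1\in(0,\frac1{3l}]$, $\tau_2=\frac1{16}(\frac3{\tau_1}+\zeta)^{-1}$ and $\beta=\alpha\min\{\mu,l\}\tau_2$, iterate $$x_{t+1}=\mathcal P_X\big(x_t-\tau_1(\nabla_x\tilde f(x_t,y_t)+p(x_t-z_t))\big),$$ $$y_{t+1}=\operatorname{prox}_{\tau_2h}\big(y_t+\tau_2\nabla_yf(A(x_{t+1}),y_t)\big),\qquad z_{t+1}=z_t+\beta(x_{t+1}-z_t),$$ where $\nabla_x\tilde f(x,y)=u(\tfrac32I_r-\tfrac12x^\top x)-x\operatorname{sym}(x^\top u)+\rho\,x(x^\top x-I_r)$ with $u=\nabla_xf(A(x),y)$ and $\operatorname{sym}(a)=\frac12(a+a^\top)$. Each iteration evaluates one gradient $\nabla_xf$ and one gradient $\nabla_yf$. **Theorem.** Let $\alpha\in(0,\frac1{2306})$. There is a constant $c>0$ depending only on $\alpha$ such that the following holds for every problem and every $C$ as above and every $z_0\in\mathcal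 M$. There exist $\bar\rho>0$ and $K>0$ such that, for every $\rho\ge\bar\rho$, every $l$ and $\tau_1$ as above, every $y_0\in Y^*(z_0)$ and $x_0\in\{z_0,x^*(z_0)\}$, the iterates $(x_t,y_t)$ of sm-MGDA started from $(x_0,y_0,z_0)$ satisfy: (a) For every $\epsilon>0$, within at most $$c\Big(1+\frac{\bar\kappa}{\epsilon^2}\Big(\frac1{\tau_1}+\zeta\Big)\big(F(z_0)-\bar F\big)\Big)$$ gradient evaluations, i.e. $\mathcal O(\bar\kappa/\epsilon^2)$, the method produces an iterate $(x_\epsilon,y_\epsilon)\in X\times Y$ such that the projection $\mathcal P_{\mathcal M}(x_\epsilon)$ is single-valued, $\|x_\epsilon-\mathcal P_{\mathcal M}(x_\epsilon)\|\le\frac3\rho\epsilon$, $\|\operatorname{grad}_xf(\mathcal P_{\mathcal M}(x_\epsilon),y_\epsilon)\|\le K\epsilon$ and $\operatorname{dist}\big(0,-\nabla_yf(\mathcal P_{\mathcal M}(x_\epsilon),y_\epsilon)+\partial h(y_\epsilon)\big)\le K\epsilon$. Here $\operatorname{grad}_xf(x,y)$ is the Riemannian gradient, i.e. the orthogonal projection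 of $\nabla_xf(x,y)$ onto the tangent space $\{\xi:x^\top\xi+\xi^\top x=0\}$. (b) Every limit point $(x^*,y^*)$ of $\{(x_t,y_t)\}_{t\ge0}$ is a stationary point of the minimax problem: $x^*\in\mathcal M$, $y^*\in Y$, $\operatorname{grad}_xf(x^*,y^*)=0$ and $0\in-\nabla_yf(x^*,y^*)+\partial h(y^*)$. -/

import Mathlib

open Set Filter Topology
open scoped ENNReal

noncomputable section

namespace SmMGDA

/-! ## Spaces, matrices and the Stiefel manifold -/

/-- The space of real `d × r` matrices with the Frobenius inner product and norm
(the Euclidean structure on the `d * r` entries). -/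
abbrev Mat (d r : ℕ) : Type := EuclideanSpace ℝ (Fin d × Fin r)

/-- The dual space `ℝ^m` with the Euclidean norm. -/
abbrev Vec (m : ℕ) : Type := EuclideanSpace ℝ (Fin m)

/-- An element of `Mat d r` as a matrix. -/
def toMat {d r : ℕ} (x : Mat d r) : Matrix (Fin d) (Fin r) ℝ :=
  Matrix.of fun i j => x (i, j)

/-- A matrix as an element of `Mat d r`. -/
def ofMat {d r : ℕ} (M : Matrix (Fin d) (Fin r) ℝ) : Mat d r :=
  WithLp.toLp 2 fun q => M q.1 q.2

/-- The symmetrization `sym(M) = (M + Mᵀ) / 2`. -/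
def symPart {r : ℕ} (M : Matrix (Fin r) (Fin r) ℝ) : Matrix (Fin r) (Fin r) ℝ :=
  (1 / 2 : ℝ) • (M + M.transpose)

/-- The defining map `c(x) = xᵀ x - I`. -/
def defMap {d r : ℕ} (x : Mat d r) : Mat r r :=
  ofMat ((toMat x).transpose * toMat x - 1)

/-- The Stiefel manifold `{x : c(x) = 0}`. -/
def stiefel (d r : ℕ) : Set (Mat d r) := {x | defMap x = 0}

/-- The constraint dissolving map `A(x) = x (3/2 I - 1/2 xᵀ x)`. -/
def dissolve {d r : ℕ} (x : Mat d r) : Mat d r :=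
  ofMat (toMat x * ((3 / 2 : ℝ) • 1 - (1 / 2 : ℝ) • ((toMat x).transpose * toMat x)))

/-- The action of the transposed Jacobian of `A` at `x`:
`∇A(x)[u] = u (3/2 I - 1/2 xᵀ x) - x sym(xᵀ u)`. -/
def gradDissolve {d r : ℕ} (x u : Mat d r) : Mat d r :=
  ofMat (toMat u * ((3 / 2 : ℝ) • 1 - (1 / 2 : ℝ) • ((toMat x).transpose * toMat x))
    - toMat x * symPart ((toMat x).transpose * toMat u))

/-- The action of the transposed Jacobian of `c` at `x` on a symmetric matrix `u`:
`∇c(x)[u] = 2 x u`. -/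
def gradDefMap {d r : ℕ} (x : Mat d r) (u : Mat r r) : Mat d r :=
  ofMat ((2 : ℝ) • (toMat x * toMat u))

/-- The tangent space `{ξ : xᵀ ξ + ξᵀ x = 0}` of the Stiefel manifold at `x`. -/
def tangentSpace {d r : ℕ} (x : Mat d r) : Submodule ℝ (Mat d r) where
  carrier := {ξ | (toMat x).transpose * toMat ξ + (toMat ξ).transpose * toMat x = 0}
  zero_mem' := by
    have : toMat (0 : Mat d r) = 0 := by ext i j; simp [toMat]
    simp [this]
  add_mem' := by
    intro a b ha hb
    have h1 : toMat (a + b) = toMat a + toMat b := by ext i j; simp [toMat]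
    simp only [mem_ofPred_eq] at ha hb ⊢
    rw [h1, Matrix.transpose_add, Matrix.mul_add, Matrix.add_mul, add_add_add_comm, ha, hb,
      add_zero]
  smul_mem' := by
    intro t a ha
    have h1 : toMat (t • a) = t • toMat a := by ext i j; simp [toMat]
    simp only [mem_ofPred_eq] at ha ⊢
    rw [h1, Matrix.transpose_smul, Matrix.mul_smul, Matrix.smul_mul, ← smul_add, ha, smul_zero]

/-- The set of nearest points of `S` to `v`, i.e. `argmin_{w ∈ S} ‖v - w‖`. -/
def nearest {d r : ℕ} (S : Set (Mat d r)) (v : Mat d r) : Set (Mat d r) :=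
  {w | w ∈ S ∧ ∀ u ∈ S, ‖v - w‖ ≤ ‖v - u‖}

/-- The projection `P_S(v)`: a nearest point of `S` to `v`
(the unique one when `S` is nonempty, closed and convex). -/
def proj {d r : ℕ} (S : Set (Mat d r)) (v : Mat d r) : Mat d r :=
  Classical.epsilon fun w => w ∈ nearest S v

/-- The Frobenius norm ball `X = {x : ‖x‖ ≤ C}`. -/
def normBall (d r : ℕ) (C : ℝ) : Set (Mat d r) := {x | ‖x‖ ≤ C}

/-- The set `X̄ = {A(x) : ‖x‖ ≤ C}`. -/
def imageBall (d r : ℕ) (C : ℝ) : Set (Mat d r) := dissolve '' normBall d r C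

/-! ## The regularizer -/

/-- The effective domain `{y : h(y) < ∞}`. -/
def edom {m : ℕ} (h : Vec m → EReal) : Set (Vec m) := {y | h y < ⊤}

/-- The standing assumption on the regularizer `h : ℝ^m → ℝ ∪ {+∞}`: it is proper, closed,
`ζ`-weakly convex, and locally Lipschitz on its domain, which is closed and bounded. -/
structure IsRegularizer {m : ℕ} (h : Vec m → EReal) (ζ : ℝ) : Prop where
  ne_bot : ∀ y, h y ≠ ⊥
  nonempty : (edom h).Nonempty
  closed : LowerSemicontinuous h
  modulus_nonneg : 0 ≤ ζ
  weaklyConvex : ConvexOn ℝ (edom h) fun y => (h y).toReal + ζ / 2 * ‖y‖ ^ 2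
  locallyLipschitz : LocallyLipschitzOn (edom h) fun y => (h y).toReal
  isClosed_dom : IsClosed (edom h)
  bounded_dom : Bornology.IsBounded (edom h)

/-- The Fréchet subdifferential `∂h(y)`: all `s` with
`liminf_{w → y} (h(w) - h(y) - ⟨s, w - y⟩) / ‖w - y‖ ≥ 0`; it is empty off the domain of `h`. -/
def subdiff {m : ℕ} (h : Vec m → EReal) (y : Vec m) : Set (Vec m) :=
  {s | y ∈ edom h ∧ ∀ ε : ℝ, 0 < ε → ∀ᶠ w in 𝓝 y,
    (((h y).toReal + inner ℝ s (w - y) - ε * ‖w - y‖ : ℝ) : EReal) ≤ h w}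

/-- `y = prox_{τ h}(v)`: `y` minimizes `τ h(w) + ‖w - v‖² / 2` over all `w`
(equivalently, over the domain of `h`). -/
def IsProx {m : ℕ} (h : Vec m → EReal) (τ : ℝ) (v y : Vec m) : Prop :=
  y ∈ edom h ∧ ∀ w ∈ edom h,
    τ * (h y).toReal + 1 / 2 * ‖y - v‖ ^ 2 ≤ τ * (h w).toReal + 1 / 2 * ‖w - v‖ ^ 2

/-- The proximal map `prox_{τ h}` (the minimizer is unique when `τ ζ < 1`). -/
def prox {m : ℕ} (h : Vec m → EReal) (τ : ℝ) (v : Vec m) : Vec m :=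
  Classical.epsilon fun y => IsProx h τ v y

/-! ## The minimax problem -/

/-- The partial gradient `∇ₓ f(x, y)`. -/
def gradX {d r m : ℕ} (f : Mat d r → Vec m → ℝ) (x : Mat d r) (y : Vec m) : Mat d r :=
  gradient (fun x' => f x' y) x

/-- The partial gradient `∇_y f(x, y)`. -/
def gradY {d r m : ℕ} (f : Mat d r → Vec m → ℝ) (x : Mat d r) (y : Vec m) : Vec m :=
  gradient (fun y' => f x y') y

/-- The partial Riemannian gradient `grad_x f(x, y)` at a point `x` of the Stiefel manifold:
the orthogonal projection of `∇ₓ f(x, y)` onto the tangent space at `x`. -/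
def riemGradX {d r m : ℕ} (f : Mat d r → Vec m → ℝ) (x : Mat d r) (y : Vec m) : Mat d r :=
  (tangentSpace x).starProjection (gradX f x y)

/-- The inner product of `Mat d r` is the Frobenius inner product. -/
theorem inner_eq_trace {d r : ℕ} (a b : Mat d r) :
    inner ℝ a b = ((toMat a).transpose * toMat b).trace := by
  simp only [PiLp.inner_apply, Matrix.trace, Matrix.diag, Matrix.mul_apply, Matrix.transpose_apply,
    toMat, Matrix.of_apply, Fintype.sum_prod_type]
  rw [Finset.sum_comm]
  simp [mul_comm]

/-- On the Stiefel manifold, `grad_x f(x, y) = ∇ₓ f(x, y) - x sym(xᵀ ∇ₓ f(x, y))`. -/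
theorem riemGradX_eq {d r m : ℕ} (f : Mat d r → Vec m → ℝ) (x : Mat d r) (y : Vec m)
    (hx : x ∈ stiefel d r) :
    riemGradX f x y = gradX f x y
      - ofMat (toMat x * symPart ((toMat x).transpose * toMat (gradX f x y))) := by
  have hxx : (toMat x).transpose * toMat x = 1 := by
    have h0 : defMap x = 0 := hx
    have h1 : toMat (defMap x) = 0 := by rw [h0]; ext i j; simp [toMat]
    have h2 : (toMat x).transpose * toMat x - 1 = 0 := h1
    exact sub_eq_zero.mp h2
  have hof : ∀ M : Matrix (Fin d) (Fin r) ℝ, toMat (ofMat M) = M := by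
    intro M; ext i j; simp [toMat, ofMat]
  have hsub : ∀ a b : Mat d r, toMat (a - b) = toMat a - toMat b := by
    intro a b; ext i j; simp [toMat]
  unfold riemGradX
  set g := gradX f x y
  set S := symPart ((toMat x).transpose * toMat g) with hS
  have hSt : S.transpose = S := by
    simp [hS, symPart, add_comm]
  refine Submodule.eq_starProjection_of_mem_of_inner_eq_zero ?_ ?_
  · change (toMat x).transpose * toMat _ + (toMat _).transpose * toMat x = 0
    rw [hsub, hof, Matrix.mul_sub, ← Matrix.mul_assoc, hxx, Matrix.transpose_sub, Matrix.sub_mul,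
      Matrix.transpose_mul, Matrix.mul_assoc, hxx, hSt]
    simp only [Matrix.one_mul, Matrix.mul_one, hS, symPart, Matrix.transpose_mul,
      Matrix.transpose_transpose]
    module
  · intro w hw
    have hw' : (toMat x).transpose * toMat w + (toMat w).transpose * toMat x = 0 := hw
    rw [sub_sub_cancel, inner_eq_trace, hof, Matrix.transpose_mul, hSt, Matrix.mul_assoc]
    have e : (S * ((toMat x).transpose * toMat w)).trace
        = (S * ((toMat w).transpose * toMat x)).trace := by
      rw [← Matrix.trace_transpose, Matrix.transpose_mul, hSt, Matrix.transpose_mul,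
        Matrix.transpose_transpose, Matrix.trace_mul_comm]
    have e2 : (S * ((toMat x).transpose * toMat w)).trace
        + (S * ((toMat w).transpose * toMat x)).trace = 0 := by
      rw [← Matrix.trace_add, ← Matrix.mul_add, hw']; simp
    linarith

/-- The set `-∇_y f(x, y) + ∂h(y)`. -/
def dualSubgrad {d r m : ℕ} (f : Mat d r → Vec m → ℝ) (h : Vec m → EReal)
    (x : Mat d r) (y : Vec m) : Set (Vec m) :=
  (fun s => -gradY f x y + s) '' subdiff h y

/-- `dist(0, -∇_y f(x, y) + ∂h(y))`, which is `∞` when the set is empty. -/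
def dualResidual {d r m : ℕ} (f : Mat d r → Vec m → ℝ) (h : Vec m → EReal)
    (x : Mat d r) (y : Vec m) : ℝ≥0∞ :=
  Metric.infEDist 0 (dualSubgrad f h x y)

/-- The primal function `F(x) = max_y (f(x, y) - h(y))`. -/
def primal {d r m : ℕ} (f : Mat d r → Vec m → ℝ) (h : Vec m → EReal) (x : Mat d r) : ℝ :=
  sSup ((fun y => f x y - (h y).toReal) '' edom h)

/-- `F̄ = min_{‖x‖ ≤ C} F(A(x))`. -/
def primalMin {d r m : ℕ} (f : Mat d r → Vec m → ℝ) (h : Vec m → EReal) (C : ℝ) : ℝ :=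
  sInf ((fun x => primal f h (dissolve x)) '' normBall d r C)

/-- The smoothness assumption on the coupling function: `f` is differentiable on an open set
containing `X̄ × dom h`, and its partial gradients are Lipschitz on `X̄ × dom h`. -/
structure IsSmoothCoupling {d r m : ℕ} (f : Mat d r → Vec m → ℝ) (h : Vec m → EReal)
    (C Lxx Lxy Lyx Lyy : ℝ) : Prop where
  differentiable : ∃ U : Set (Mat d r × Vec m), IsOpen U ∧ imageBall d r C ×ˢ edom h ⊆ U ∧
    DifferentiableOn ℝ (fun q : Mat d r × Vec m => f q.1 q.2) U
  nonneg : 0 ≤ Lxx ∧ 0 ≤ Lxy ∧ 0 ≤ Lyx ∧ 0 ≤ Lyy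
  lipschitz_x : ∀ x₁ ∈ imageBall d r C, ∀ x₂ ∈ imageBall d r C, ∀ y₁ ∈ edom h, ∀ y₂ ∈ edom h,
    ‖gradX f x₁ y₁ - gradX f x₂ y₂‖ ≤ Lxx * ‖x₁ - x₂‖ + Lxy * ‖y₁ - y₂‖
  lipschitz_y : ∀ x₁ ∈ imageBall d r C, ∀ x₂ ∈ imageBall d r C, ∀ y₁ ∈ edom h, ∀ y₂ ∈ edom h,
    ‖gradY f x₁ y₁ - gradY f x₂ y₂‖ ≤ Lyx * ‖x₁ - x₂‖ + Lyy * ‖y₁ - y₂‖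

/-- `h - f(x, ·)` satisfies the Polyak–Łojasiewicz inequality with constant `μ > 0`, uniformly
in `x ∈ X̄`: `2 μ (F(x) - f(x, y) + h(y)) ≤ dist(0, -∇_y f(x, y) + ∂h(y))²` for `y ∈ dom h`. -/
def IsUniformlyPL {d r m : ℕ} (f : Mat d r → Vec m → ℝ) (h : Vec m → EReal) (C μ : ℝ) : Prop :=
  0 < μ ∧ ∀ x ∈ imageBall d r C, ∀ y ∈ edom h,
    ENNReal.ofReal (2 * μ * (primal f h x - (f x y - (h y).toReal))) ≤ dualResidual f h x y ^ 2

/-! ## The penalized problem and its smoothing -/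

/-- The penalized coupling function `f̃(x, y) = f(A(x), y) + ρ/4 ‖c(x)‖²`. -/
def penalized {d r m : ℕ} (f : Mat d r → Vec m → ℝ) (ρ : ℝ) (x : Mat d r) (y : Vec m) : ℝ :=
  f (dissolve x) y + ρ / 4 * ‖defMap x‖ ^ 2

/-- `l > 0` bounds all four blocks of Lipschitz constants of `∇f̃` on `X × dom h`. -/
def IsPenalizedLipschitz {d r m : ℕ} (f : Mat d r → Vec m → ℝ) (h : Vec m → EReal)
    (ρ C l : ℝ) : Prop :=
  0 < l ∧ ∀ x₁ ∈ normBall d r C, ∀ x₂ ∈ normBall d r C, ∀ y₁ ∈ edom h, ∀ y₂ ∈ edom h,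
    ‖gradX (penalized f ρ) x₁ y₁ - gradX (penalized f ρ) x₂ y₂‖
        ≤ l * ‖x₁ - x₂‖ + l * ‖y₁ - y₂‖ ∧
    ‖gradY (penalized f ρ) x₁ y₁ - gradY (penalized f ρ) x₂ y₂‖
        ≤ l * ‖x₁ - x₂‖ + l * ‖y₁ - y₂‖

/-- `f̂(x, y; z) = f̃(x, y) + p/2 ‖x - z‖²`. -/
def smoothed {d r m : ℕ} (f : Mat d r → Vec m → ℝ) (ρ p : ℝ) (x : Mat d r) (y : Vec m)
    (z : Mat d r) : ℝ :=
  penalized f ρ x y + p / 2 * ‖x - z‖ ^ 2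

/-- `Φ(x; z) = max_y (f̂(x, y; z) - h(y))`. -/
def auxPrimal {d r m : ℕ} (f : Mat d r → Vec m → ℝ) (h : Vec m → EReal) (ρ p : ℝ)
    (x z : Mat d r) : ℝ :=
  sSup ((fun y => smoothed f ρ p x y z - (h y).toReal) '' edom h)

/-- `Ψ_r(y; z) = min_{x ∈ X} f̂(x, y; z) - h(y)`, for `y ∈ dom h`. -/
def auxDual {d r m : ℕ} (f : Mat d r → Vec m → ℝ) (h : Vec m → EReal) (ρ p C : ℝ)
    (y : Vec m) (z : Mat d r) : ℝ :=
  sInf ((fun x => smoothed f ρ p x y z) '' normBall d r C) - (h y).toReal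

/-- `argmin_{x ∈ X} Φ(x; z)` (a single point `x*(z)` when `p` exceeds the Lipschitz constant). -/
def primalSol {d r m : ℕ} (f : Mat d r → Vec m → ℝ) (h : Vec m → EReal) (ρ p C : ℝ)
    (z : Mat d r) : Set (Mat d r) :=
  {x | x ∈ normBall d r C ∧
    ∀ w ∈ normBall d r C, auxPrimal f h ρ p x z ≤ auxPrimal f h ρ p w z}

/-- `Y*(z) = argmax_y Ψ_r(y; z)`. -/
def dualSol {d r m : ℕ} (f : Mat d r → Vec m → ℝ) (h : Vec m → EReal) (ρ p C : ℝ)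
    (z : Mat d r) : Set (Vec m) :=
  {y | y ∈ edom h ∧ ∀ w ∈ edom h, auxDual f h ρ p C w z ≤ auxDual f h ρ p C y z}

/-! ## The algorithm -/

/-- The parameters of the method. -/
structure Params where
  θ : ℕ → ℝ
  τ₁ : ℕ → ℝ
  τ₂ : ℝ
  p : ℝ
  ρ : ℝ
  C : ℝ
  β : ℝ

/-- The iterates together with the number of evaluations of partial gradients of `f` so far. -/
structure State (d r m : ℕ) where
  x : Mat d r
  y : Vec m
  z : Mat d r
  gradEvals : ℕ

/-- One iteration of smoothed manifold gradient descent ascent. It evaluates one gradient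
`∇ₓ f(A(x_t), y_t)` and one gradient `∇_y f(A(x_{t+1}), y_t)`. -/
def step {d r m : ℕ} (f : Mat d r → Vec m → ℝ) (h : Vec m → EReal) (P : Params) (t : ℕ)
    (s : State d r m) : State d r m :=
  let g : Mat d r := gradDissolve s.x (gradX f (dissolve s.x) s.y)
    + (P.ρ / 2) • gradDefMap s.x (defMap s.x)
  let x' : Mat d r := proj (normBall d r P.C) (s.x - P.τ₁ t • (g + P.p • (s.x - s.z)))
  let y' : Vec m := prox h P.τ₂ (s.y + P.τ₂ • (gradY f (dissolve x') s.y - P.θ t • s.y))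
  let z' : Mat d r := s.z + P.β • (x' - s.z)
  { x := x', y := y', z := z', gradEvals := s.gradEvals + 2 }

/-- The state of the method after `t` iterations from `(x₀, y₀, z₀)`. -/
def run {d r m : ℕ} (f : Mat d r → Vec m → ℝ) (h : Vec m → EReal) (P : Params)
    (x₀ : Mat d r) (y₀ : Vec m) (z₀ : Mat d r) : ℕ → State d r m
  | 0 => { x := x₀, y := y₀, z := z₀, gradEvals := 0 }
  | t + 1 => step f h P t (run f h P x₀ y₀ z₀ t)

/-- The parameters for the PL setting: `θ_t = 0`, constant `τ₁`, `τ₂ = (3/τ₁ + ζ)⁻¹ / 16`,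
`p = 2 l` and `β = α min{μ, l} τ₂`. -/
def plParams (ζ μ α l τ₁ ρ C : ℝ) : Params where
  θ := fun _ => 0
  τ₁ := fun _ => τ₁
  τ₂ := 1 / 16 * (3 / τ₁ + ζ)⁻¹
  p := 2 * l
  ρ := ρ
  C := C
  β := α * min μ l * (1 / 16 * (3 / τ₁ + ζ)⁻¹)

/-- Stationarity for `min_{x ∈ St} max_y f(x, y) - h(y)`: `x` lies on the Stiefel manifold,
`grad_x f(x, y) = 0` and `0 ∈ -∇_y f(x, y) + ∂h(y)`. -/
def IsStationary {d r m : ℕ} (f : Mat d r → Vec m → ℝ) (h : Vec m → EReal)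
    (x : Mat d r) (y : Vec m) : Prop :=
  x ∈ stiefel d r ∧ y ∈ edom h ∧ riemGradX f x y = 0 ∧ 0 ∈ dualSubgrad f h x y

end SmMGDA

end

/-! Two mechanisms combine: a Lyapunov argument for an abstract game (`IsRegularGame`, no matrices
involved) and exact penalization.

Lyapunov argument. With `p = 2l` the smoothed function is `l`-strongly convex in `x`; write `Ψ(y;
z)` for its minimum over `x` minus `η y`. The PL inequality replaces concavity in `y`: it produces a
saddle point for every `z` (`isSaddle_of_dualMax`, `exists_isSaddle`) and bounds the distance from
the inner minimizer to the saddle by the dual residual (`saddle_error_bound`). Let `P(z)` be the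
saddle value and `φ` the smoothed value at the current iterate. The potential `V = φ - 2Ψ + 2P`
drops in each iteration by a multiple of the squared steps (`potential_step`); the one harmful term,
the squared distance from inner minimizer to saddle created by moving `z`, is absorbed by the error
bound because `β` is small. Since `y₀` maximizes `Ψ(·; z₀)`, `V` starts below `F(z₀)`, and it never
falls below `F̄` (`sum_decrease_le`). The squared stationarity residual is at most of order `κ̄
(1/τ₁ + ζ)` times the decrease, whence the rate `κ̄/ε²`.

Exact penalization. `V` also dominates the penalized value at the iterate, so `ρ/4 ‖c(x)‖²` is
bounded independently of `ρ`, and a large `ρ` forces `‖c(x)‖ ≤ 1/2` along the whole trajectory.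
There the polar factor is the only nearest point of the manifold, at distance at most `‖c(x)‖`
(`nearest_stiefel_eq_singleton`); hence `‖x‖ < C`, the ball constraint is inactive, and the residual
bounds the full gradient of the penalized function. Testing this gradient against `x c(x)` gives `ρ
‖c(x)‖ ≤ 6 ‖∇‖` (`norm_defMap_le_of_penalized`), and moving from `x` to its projection costs
constants free of `ρ` (`near_stationary`).

Limit points are stationary because the residual tends to zero and the subgradient inequalities of a
`ζ`-weakly convex function have a fixed modulus, so they survive limits. -/

namespace SmMGDA

open scoped RealInnerProductSpace

/-! ### Matrix arithmetic in the Frobenius norm. -/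

section MatrixAlgebra

variable {a b c d : ℕ}

@[simp] theorem toMat_ofMat (M : Matrix (Fin a) (Fin b) ℝ) : toMat (ofMat M) = M := rfl

@[simp] theorem ofMat_toMat (x : Mat a b) : ofMat (toMat x) = x := rfl

theorem toMat_injective : Function.Injective (toMat : Mat a b → Matrix (Fin a) (Fin b) ℝ) :=
  fun x y h => by rw [← ofMat_toMat x, h, ofMat_toMat]

@[simp] theorem toMat_add (x y : Mat a b) : toMat (x + y) = toMat x + toMat y := rfl

@[simp] theorem toMat_sub (x y : Mat a b) : toMat (x - y) = toMat x - toMat y := rfl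

@[simp] theorem toMat_smul (s : ℝ) (x : Mat a b) : toMat (s • x) = s • toMat x := rfl

@[simp] theorem toMat_zero : toMat (0 : Mat a b) = 0 := rfl

/-- Matrix multiplication on `Mat`. -/
def mmul (x : Mat a b) (y : Mat b c) : Mat a c := ofMat (toMat x * toMat y)

/-- Matrix transposition on `Mat`. -/
def mtr (x : Mat a b) : Mat b a := ofMat (toMat x).transpose

/-- The identity matrix in `Mat`. -/
def mone (a : ℕ) : Mat a a := ofMat 1

@[simp] theorem toMat_mmul (x : Mat a b) (y : Mat b c) : toMat (mmul x y) = toMat x * toMat y := rfl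

@[simp] theorem toMat_mtr (x : Mat a b) : toMat (mtr x) = (toMat x).transpose := rfl

@[simp] theorem toMat_mone : toMat (mone a) = 1 := rfl

theorem mmul_assoc (x : Mat a b) (y : Mat b c) (z : Mat c d) :
    mmul (mmul x y) z = mmul x (mmul y z) :=
  toMat_injective (by simp [Matrix.mul_assoc])

theorem add_mmul (x y : Mat a b) (z : Mat b c) : mmul (x + y) z = mmul x z + mmul y z :=
  toMat_injective (by simp [Matrix.add_mul])

theorem mmul_add (x : Mat a b) (y z : Mat b c) : mmul x (y + z) = mmul x y + mmul x z :=
  toMat_injective (by simp [Matrix.mul_add])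

theorem sub_mmul (x y : Mat a b) (z : Mat b c) : mmul (x - y) z = mmul x z - mmul y z :=
  toMat_injective (by simp [Matrix.sub_mul])

theorem mmul_sub (x : Mat a b) (y z : Mat b c) : mmul x (y - z) = mmul x y - mmul x z :=
  toMat_injective (by simp [Matrix.mul_sub])

@[simp] theorem smul_mmul (s : ℝ) (x : Mat a b) (y : Mat b c) : mmul (s • x) y = s • mmul x y :=
  toMat_injective (by simp)

@[simp] theorem mmul_smul (s : ℝ) (x : Mat a b) (y : Mat b c) : mmul x (s • y) = s • mmul x y :=
  toMat_injective (by simp)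

@[simp] theorem mmul_mone (x : Mat a b) : mmul x (mone b) = x := toMat_injective (by simp)

@[simp] theorem mone_mmul (x : Mat a b) : mmul (mone a) x = x := toMat_injective (by simp)

@[simp] theorem mmul_zero (x : Mat a b) : mmul x (0 : Mat b c) = 0 := toMat_injective (by simp)

@[simp] theorem mtr_mtr (x : Mat a b) : mtr (mtr x) = x := rfl

@[simp] theorem mtr_add (x y : Mat a b) : mtr (x + y) = mtr x + mtr y := rfl

@[simp] theorem mtr_sub (x y : Mat a b) : mtr (x - y) = mtr x - mtr y := rfl

@[simp] theorem mtr_smul (s : ℝ) (x : Mat a b) : mtr (s • x) = s • mtr x := rfl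

@[simp] theorem mtr_mone : mtr (mone a) = mone a := toMat_injective (by simp)

@[simp] theorem mtr_mmul (x : Mat a b) (y : Mat b c) : mtr (mmul x y) = mmul (mtr y) (mtr x) :=
  toMat_injective (by simp)

theorem inner_mmul_left (x : Mat a b) (y : Mat b c) (z : Mat a c) :
    ⟪mmul x y, z⟫ = ⟪y, mmul (mtr x) z⟫ := by
  simp [inner_eq_trace, Matrix.mul_assoc]

theorem inner_mtr (x y : Mat a b) : ⟪mtr x, mtr y⟫ = ⟪x, y⟫ := by
  rw [inner_eq_trace, inner_eq_trace, ← Matrix.trace_transpose (_ * toMat y),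
    toMat_mtr, toMat_mtr, Matrix.transpose_transpose, Matrix.trace_mul_comm,
    Matrix.transpose_mul, Matrix.transpose_transpose]

theorem inner_mmul_right (x : Mat a b) (y : Mat b c) (z : Mat a c) :
    ⟪mmul x y, z⟫ = ⟪x, mmul z (mtr y)⟫ := by
  rw [← inner_mtr, mtr_mmul, inner_mmul_left, ← inner_mtr]
  simp

@[simp] theorem norm_mtr (x : Mat a b) : ‖mtr x‖ = ‖x‖ := by
  have h := inner_mtr x x
  rw [real_inner_self_eq_norm_sq, real_inner_self_eq_norm_sq] at h
  exact (pow_left_inj₀ (norm_nonneg _) (norm_nonneg _) two_ne_zero).1 h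

theorem norm_mmul_le (x : Mat a b) (y : Mat b c) : ‖mmul x y‖ ≤ ‖x‖ * ‖y‖ := by
  refine abs_le_of_sq_le_sq' ?_ (by positivity) |>.2
  rw [mul_pow, EuclideanSpace.real_norm_sq_eq, EuclideanSpace.real_norm_sq_eq,
    EuclideanSpace.real_norm_sq_eq, Fintype.sum_prod_type, Fintype.sum_prod_type,
    Fintype.sum_prod_type_right, Finset.sum_mul_sum]
  refine Finset.sum_le_sum fun i _ => Finset.sum_le_sum fun j _ => ?_
  have h : mmul x y (i, j) = ∑ k, x (i, k) * y (k, j) := rfl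
  rw [h]
  exact Finset.sum_mul_sq_le_sq_mul_sq _ _ _

/-- Matrix multiplication as a continuous bilinear map. -/
noncomputable def mmulL (a b c : ℕ) : Mat a b →L[ℝ] Mat b c →L[ℝ] Mat a c :=
  LinearMap.mkContinuous₂
    (LinearMap.mk₂ ℝ mmul add_mmul smul_mmul mmul_add mmul_smul) 1
    fun x y => by simpa using norm_mmul_le x y

@[simp] theorem mmulL_apply (x : Mat a b) (y : Mat b c) : mmulL a b c x y = mmul x y := rfl

/-- Matrix transposition as a continuous linear map. -/
noncomputable def mtrL (a b : ℕ) : Mat a b →L[ℝ] Mat b a :=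
  LinearMap.mkContinuous { toFun := mtr, map_add' := mtr_add, map_smul' := mtr_smul } 1
    fun x => by simp

@[simp] theorem mtrL_apply (x : Mat a b) : mtrL a b x = mtr x := rfl

@[fun_prop]
theorem continuous_mmul {S : Type*} [TopologicalSpace S] {p : S → Mat a b} {q : S → Mat b c}
    (hp : Continuous p) (hq : Continuous q) : Continuous fun s => mmul (p s) (q s) :=
  ((mmulL a b c).continuous.comp hp).clm_apply hq

@[fun_prop]
theorem continuous_mtr {S : Type*} [TopologicalSpace S] {p : S → Mat a b}
    (hp : Continuous p) : Continuous fun s => mtr (p s) :=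
  (mtrL a b).continuous.comp hp

/-- Symmetrization on `Mat`. -/
noncomputable def msym (x : Mat a a) : Mat a a := (1 / 2 : ℝ) • (x + mtr x)

@[fun_prop]
theorem continuous_msym {S : Type*} [TopologicalSpace S] {p : S → Mat a a}
    (hp : Continuous p) : Continuous fun s => msym (p s) := by
  unfold msym
  fun_prop

theorem norm_msym_le (x : Mat a a) : ‖msym x‖ ≤ ‖x‖ := by
  have := norm_add_le x (mtr x)
  rw [norm_mtr] at this
  rw [msym, norm_smul]
  norm_num
  linarith

theorem inner_msym_comm (x y : Mat a a) : ⟪msym x, y⟫ = ⟪x, msym y⟫ := by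
  have h := inner_mtr x (mtr y)
  rw [mtr_mtr] at h
  simp [msym, inner_smul_left, inner_smul_right, inner_add_left, inner_add_right, h]

theorem msym_eq_self {x : Mat a a} (hx : mtr x = x) : msym x = x := by
  rw [msym, hx, ← two_smul ℝ, smul_smul]
  norm_num

/-! ### The dissolving map, the constraint map and their derivatives. -/

variable {r : ℕ}

theorem defMap_eq (x : Mat d r) : defMap x = mmul (mtr x) x - mone r := rfl

theorem dissolve_eq (x : Mat d r) : dissolve x = x - (1 / 2 : ℝ) • mmul x (defMap x) := by
  refine toMat_injective ?_
  rw [dissolve, toMat_ofMat, defMap_eq]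
  simp only [toMat_sub, toMat_smul, toMat_mmul, toMat_mtr, toMat_mone, Matrix.mul_sub,
    Matrix.mul_smul, Matrix.mul_one, smul_sub]
  module

theorem gradDissolve_eq (x u : Mat d r) :
    gradDissolve x u = u - (1 / 2 : ℝ) • mmul u (defMap x) - mmul x (msym (mmul (mtr x) u)) := by
  refine toMat_injective ?_
  rw [gradDissolve, toMat_ofMat, defMap_eq, msym, symPart]
  simp only [toMat_sub, toMat_add, toMat_smul, toMat_mmul, toMat_mtr, toMat_mone, Matrix.mul_sub,
    Matrix.mul_smul, Matrix.mul_one, smul_sub]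
  module

theorem gradDefMap_eq (x : Mat d r) (u : Mat r r) : gradDefMap x u = (2 : ℝ) • mmul x u := rfl

@[simp] theorem mtr_defMap (x : Mat d r) : mtr (defMap x) = defMap x := by
  simp [defMap_eq]

theorem mtr_mmul_self (x : Mat d r) : mmul (mtr x) x = mone r + defMap x := by
  rw [defMap_eq]; abel

theorem continuous_defMap : Continuous (defMap : Mat d r → Mat r r) := by
  simp_rw [funext defMap_eq]
  fun_prop

theorem continuous_dissolve : Continuous (dissolve : Mat d r → Mat d r) := by
  have := continuous_defMap (d := d) (r := r)
  simp_rw [funext dissolve_eq]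
  fun_prop

theorem continuous_gradDissolve :
    Continuous fun q : Mat d r × Mat d r => gradDissolve q.1 q.2 := by
  have := continuous_defMap (d := d) (r := r)
  simp_rw [gradDissolve_eq]
  fun_prop

theorem hasFDerivAt_defMap (x : Mat d r) : ∃ D : Mat d r →L[ℝ] Mat r r,
    HasFDerivAt defMap D x ∧ ∀ v, D v = mmul (mtr x) v + mmul (mtr v) x := by
  have h := (mmulL r d r).hasFDerivAt_of_bilinear (mtrL d r).hasFDerivAt (hasFDerivAt_id x)
  refine ⟨_, (h.sub_const (mone r)), fun v => ?_⟩
  simp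

/-- In the derivative of `x - ½ x c(x)` the map `v ↦ xᵀv + vᵀx` is twice a symmetrization.
Symmetrization is self-adjoint, so it can be moved onto `xᵀu`, which produces `gradDissolve`. -/
theorem hasFDerivAt_dissolve (x : Mat d r) : ∃ D : Mat d r →L[ℝ] Mat d r,
    HasFDerivAt dissolve D x ∧ ∀ u v, ⟪u, D v⟫ = ⟪gradDissolve x u, v⟫ := by
  obtain ⟨D, hD, hDv⟩ := hasFDerivAt_defMap x
  have h := (mmulL d r r).hasFDerivAt_of_bilinear (hasFDerivAt_id x) hD
  have h2 := (hasFDerivAt_id x).sub (h.const_smul (1 / 2 : ℝ))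
  refine ⟨_, (h2.congr_of_eventuallyEq (.of_forall fun y => dissolve_eq y)), fun u v => ?_⟩
  have e1 : ⟪u, mmul v (defMap x)⟫ = ⟪mmul u (defMap x), v⟫ := by
    rw [real_inner_comm, inner_mmul_right, mtr_defMap, real_inner_comm]
  have e2 : ⟪u, mmul x (mmul (mtr x) v + mmul (mtr v) x)⟫
      = 2 * ⟪mmul x (msym (mmul (mtr x) u)), v⟫ := by
    have hsym : mmul (mtr x) v + mmul (mtr v) x = (2 : ℝ) • msym (mmul (mtr x) v) := by
      simp [msym]
    rw [hsym, mmul_smul, inner_smul_right, real_inner_comm, inner_mmul_left, inner_mmul_left,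
      inner_msym_comm, real_inner_comm]
  have hD2 : (mmulL d r r).precompR (Mat d r) (id x) D v
      + (mmulL d r r).precompL (Mat d r) (ContinuousLinearMap.id ℝ (Mat d r)) (defMap x) v
      = mmul x (mmul (mtr x) v + mmul (mtr v) x) + mmul v (defMap x) := by
    simp [hDv]
  change ⟪u, v - (1 / 2 : ℝ) • ((mmulL d r r).precompR (Mat d r) (id x) D v
      + (mmulL d r r).precompL (Mat d r) (ContinuousLinearMap.id ℝ (Mat d r)) (defMap x) v)⟫ = _
  rw [hD2, gradDissolve_eq, inner_sub_right, inner_smul_right, inner_add_right, e1, e2,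
    inner_sub_left, inner_sub_left, inner_smul_left, conj_trivial]
  ring

theorem hasGradientAt_penalized {m : ℕ} {f : Mat d r → Vec m → ℝ} (ρ : ℝ) {x : Mat d r} {y : Vec m}
    (hf : DifferentiableAt ℝ (fun x' => f x' y) (dissolve x)) :
    HasGradientAt (fun x' => penalized f ρ x' y)
      (gradDissolve x (gradX f (dissolve x) y) + (ρ / 2) • gradDefMap x (defMap x)) x := by
  obtain ⟨D, hD, hDv⟩ := hasFDerivAt_dissolve x
  obtain ⟨D', hD', hDv'⟩ := hasFDerivAt_defMap x
  have h1 := hf.hasGradientAt.hasFDerivAt.comp x hD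
  have h2 := (hD'.norm_sq).const_mul (ρ / 4)
  have h3 := h1.add h2
  rw [hasGradientAt_iff_hasFDerivAt]
  refine h3.congr_fderiv (ContinuousLinearMap.ext fun v => ?_)
  have e : ⟪defMap x, D' v⟫ = 2 * ⟪mmul x (defMap x), v⟫ := by
    rw [hDv', inner_mmul_left, show mmul (mtr x) v + mmul (mtr v) x
      = (2 : ℝ) • msym (mmul (mtr x) v) by simp [msym], inner_smul_right, ← inner_msym_comm,
      msym_eq_self (mtr_defMap x)]
  have e' : ⟪gradX f (dissolve x) y, D v⟫ = ⟪gradDissolve x (gradX f (dissolve x) y), v⟫ :=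
    hDv _ _
  change ⟪gradX f (dissolve x) y, D v⟫ + ρ / 4 * ((2 : ℕ) • ⟪defMap x, D' v⟫) = ⟪_, v⟫
  rw [e, e', inner_add_left, inner_smul_left, gradDefMap_eq, inner_smul_left, nsmul_eq_mul]
  simp only [conj_trivial]
  push_cast
  ring

/-! ### Polar decomposition and projection onto the Stiefel manifold. -/

theorem mem_stiefel_iff {x : Mat d r} : x ∈ stiefel d r ↔ mmul (mtr x) x = mone r := by
  change defMap x = 0 ↔ _
  rw [defMap_eq, sub_eq_zero]

theorem norm_mmul_of_mem_stiefel {U : Mat d r} (hU : U ∈ stiefel d r) (A : Mat r a) :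
    ‖mmul U A‖ = ‖A‖ := by
  have h : ‖mmul U A‖ ^ 2 = ‖A‖ ^ 2 := by
    rw [← real_inner_self_eq_norm_sq, inner_mmul_left, ← mmul_assoc, mem_stiefel_iff.1 hU,
      mone_mmul, real_inner_self_eq_norm_sq]
  exact (pow_left_inj₀ (norm_nonneg _) (norm_nonneg _) two_ne_zero).1 h

theorem norm_of_mem_stiefel {U : Mat d r} (hU : U ∈ stiefel d r) : ‖U‖ = ‖mone r‖ := by
  rw [← norm_mmul_of_mem_stiefel hU, mmul_mone]

theorem dissolve_of_mem_stiefel {U : Mat d r} (hU : U ∈ stiefel d r) : dissolve U = U := by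
  rw [dissolve_eq, show defMap U = 0 from hU]
  simp

open scoped MatrixOrder in
/-- The symmetric positive semidefinite square root of `xᵀ x`. -/
theorem exists_sqrt_gram (x : Mat d r) : ∃ S B : Mat r r,
    mtr S = S ∧ S = mmul (mtr B) B ∧ mmul S S = mmul (mtr x) x := by
  have hM : (0 : Matrix (Fin r) (Fin r) ℝ) ≤ (toMat x).transpose * toMat x := by
    rw [Matrix.nonneg_iff_posSemidef]
    exact Matrix.posSemidef_conjTranspose_mul_self (toMat x)
  have hS := CFC.sqrt_nonneg ((toMat x).transpose * toMat x)
  have hB := CFC.sqrt_nonneg (CFC.sqrt ((toMat x).transpose * toMat x))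
  have hBt : (CFC.sqrt (CFC.sqrt ((toMat x).transpose * toMat x))).transpose
      = CFC.sqrt (CFC.sqrt ((toMat x).transpose * toMat x)) :=
    (Matrix.nonneg_iff_posSemidef.1 hB).1
  refine ⟨ofMat (CFC.sqrt ((toMat x).transpose * toMat x)),
    ofMat (CFC.sqrt (CFC.sqrt ((toMat x).transpose * toMat x))), ?_, ?_, ?_⟩
  · exact toMat_injective (Matrix.nonneg_iff_posSemidef.1 hS).1
  · refine toMat_injective ?_
    rw [toMat_mmul, toMat_mtr, toMat_ofMat, toMat_ofMat, hBt, CFC.sqrt_mul_sqrt_self _ hS]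
  · exact toMat_injective (CFC.sqrt_mul_sqrt_self _ hM)

/-- Since `S² = 1 + c(x)`, a kernel vector `w` of `S` satisfies `w = -c(x) w`, which `‖c(x)‖ < 1`
excludes unless `w = 0`. -/
theorem exists_inverse_sqrt {x : Mat d r} (hx : ‖defMap x‖ ≤ 1 / 2) {S : Mat r r}
    (hS : mmul S S = mmul (mtr x) x) : ∃ R : Mat r r, mmul S R = mone r ∧ mmul R S = mone r := by
  have hdet : (toMat S).det ≠ 0 := by
    intro h0
    obtain ⟨v, hv, hv0⟩ := Matrix.exists_mulVec_eq_zero_iff.2 h0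
    set w : Mat r 1 := ofMat (Matrix.of fun i _ => v i) with hw
    have h1 : mmul S w = 0 := by
      refine toMat_injective ?_
      ext i j
      exact congrFun hv0 i
    have h2 : mmul (mone r + defMap x) w = 0 := by
      rw [← mtr_mmul_self, ← hS, mmul_assoc, h1, mmul_zero]
    rw [add_mmul, mone_mmul] at h2
    have h3 : ‖w‖ ≤ ‖defMap x‖ * ‖w‖ := by
      have h := norm_mmul_le (defMap x) w
      rwa [eq_neg_of_add_eq_zero_right h2, norm_neg] at h
    have h4 : ‖w‖ = 0 := by nlinarith [norm_nonneg w]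
    rw [norm_eq_zero] at h4
    refine hv (funext fun i => ?_)
    have : w (i, 0) = 0 := by rw [h4]; rfl
    exact this
  have hu : IsUnit (toMat S).det := isUnit_iff_ne_zero.2 hdet
  exact ⟨ofMat (toMat S)⁻¹, toMat_injective (Matrix.mul_nonsing_inv _ hu),
    toMat_injective (Matrix.nonsing_inv_mul _ hu)⟩

/-- Near the Stiefel manifold the projection is single-valued (it is the polar factor), and the
distance to the manifold is at most `‖c(x)‖`. -/
theorem nearest_stiefel_eq_singleton {x : Mat d r} (hx : ‖defMap x‖ ≤ 1 / 2) :
    ∃ U ∈ stiefel d r, nearest (stiefel d r) x = {U} ∧ ‖x - U‖ ≤ ‖defMap x‖ := by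
  obtain ⟨S, B, hSt, hSB, hSS⟩ := exists_sqrt_gram x
  obtain ⟨R, hSR, hRS⟩ := exists_inverse_sqrt hx hSS
  have hRt : mtr R = R := by
    have h : mmul (mtr R) S = mone r := by
      rw [← hSt, ← mtr_mmul, hSR, mtr_mone]
    calc mtr R = mmul (mtr R) (mmul S R) := by rw [hSR, mmul_mone]
      _ = R := by rw [← mmul_assoc, h, mone_mmul]
  -- Positivity of `S` enters only through the factorization `S = BᵀB`.
  have hquad : ∀ {k : ℕ} (W : Mat k r), ⟪mmul W S, W⟫ = ‖mmul W (mtr B)‖ ^ 2 := by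
    intro k W
    rw [hSB, ← mmul_assoc, inner_mmul_right, real_inner_self_eq_norm_sq]
  set U := mmul x R with hUdef
  have hUS : mmul U S = x := by rw [hUdef, mmul_assoc, hRS, mmul_mone]
  have hU : U ∈ stiefel d r := by
    rw [mem_stiefel_iff, hUdef, mtr_mmul, hRt, mmul_assoc, ← mmul_assoc (mtr x), ← hSS,
      mmul_assoc, hSR, mmul_mone, hRS]
  -- On the manifold `⟨WS, W⟩` is the trace of `S`, independent of `W`, so the excess squared
  -- distance is exactly the `S`-quadratic form of `W - U`.
  have hdiff : ∀ W ∈ stiefel d r,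
      ‖x - W‖ ^ 2 = ‖x - U‖ ^ 2 + ‖mmul (W - U) (mtr B)‖ ^ 2 := by
    intro W hW
    have e1 : ⟪mmul W S, W⟫ = ⟪mmul U S, U⟫ := by
      rw [inner_mmul_left, inner_mmul_left, mem_stiefel_iff.1 hW, mem_stiefel_iff.1 hU]
    have e2 : ⟪mmul W S, U⟫ = ⟪mmul U S, W⟫ := by
      rw [inner_mmul_right, hSt, real_inner_comm]
    rw [← hquad, norm_sub_sq_real, norm_sub_sq_real, norm_of_mem_stiefel hW,
      norm_of_mem_stiefel hU, sub_mmul, inner_sub_left, inner_sub_right, inner_sub_right, e1, e2,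
      hUS]
    ring
  refine ⟨U, hU, ?_, ?_⟩
  · refine Set.eq_singleton_iff_unique_mem.2 ⟨⟨hU, fun W hW => ?_⟩, fun W hW => ?_⟩
    · refine (pow_le_pow_iff_left₀ (norm_nonneg _) (norm_nonneg _) two_ne_zero).1 ?_
      rw [hdiff W hW]
      exact le_add_of_nonneg_right (sq_nonneg _)
    · have h1 := hdiff W hW.1
      have h2 := pow_le_pow_left₀ (norm_nonneg _) (hW.2 U hU) 2
      have h3 : ‖mmul (W - U) (mtr B)‖ = 0 := pow_eq_zero_iff two_ne_zero |>.1
        (le_antisymm (by linarith) (sq_nonneg _))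
      have h4 : mmul (W - U) S = 0 := by
        rw [hSB, ← mmul_assoc, norm_eq_zero.1 h3]
        exact toMat_injective (by simp)
      have h5 : W - U = mmul (mmul (W - U) S) R := by rw [mmul_assoc, hSR, mmul_mone]
      rw [h4] at h5
      refine sub_eq_zero.1 (h5.trans (toMat_injective (by simp)))
  · have e1 : x - U = mmul U (S - mone r) := by rw [mmul_sub, hUS, mmul_mone]
    -- `c(x) = S² - 1`; the cross term `⟨(S - 1)S, S - 1⟩` is nonnegative, so `‖S - 1‖ ≤ ‖c(x)‖`.
    have e2 : defMap x = mmul (S - mone r) S + (S - mone r) := by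
      rw [defMap_eq, ← hSS, sub_mmul, mone_mmul]
      abel
    rw [e1, norm_mmul_of_mem_stiefel hU, e2]
    refine (pow_le_pow_iff_left₀ (norm_nonneg _) (norm_nonneg _) two_ne_zero).1 ?_
    rw [norm_add_sq_real, hquad]
    nlinarith [sq_nonneg ‖mmul (S - mone r) S‖, sq_nonneg ‖mmul (S - mone r) (mtr B)‖]

/-! ### Infeasibility and gradients near the manifold. -/

theorem norm_mmul_defMap_sq (x : Mat d r) :
    ‖mmul x (defMap x)‖ ^ 2 = ‖defMap x‖ ^ 2 + ⟪defMap x, mmul (defMap x) (defMap x)⟫ := by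
  rw [← real_inner_self_eq_norm_sq, inner_mmul_left, ← mmul_assoc, mtr_mmul_self, add_mmul,
    mone_mmul, inner_add_right, real_inner_self_eq_norm_sq]

theorem abs_inner_defMap_cube_le {x : Mat d r} (hx : ‖defMap x‖ ≤ 1 / 2) :
    |⟪defMap x, mmul (defMap x) (defMap x)⟫| ≤ 1 / 2 * ‖defMap x‖ ^ 2 := by
  have h1 := abs_real_inner_le_norm (defMap x) (mmul (defMap x) (defMap x))
  have h2 := norm_mmul_le (defMap x) (defMap x)
  have h0 := norm_nonneg (defMap x)
  nlinarith [mul_le_mul_of_nonneg_left h2 h0, mul_le_mul_of_nonneg_right hx (sq_nonneg ‖defMap x‖)]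

theorem norm_mmul_defMap_le {x : Mat d r} (hx : ‖defMap x‖ ≤ 1 / 2) :
    ‖mmul x (defMap x)‖ ≤ 3 / 2 * ‖defMap x‖ := by
  refine (pow_le_pow_iff_left₀ (norm_nonneg _) (by positivity) two_ne_zero).1 ?_
  rw [norm_mmul_defMap_sq]
  have := (abs_le.1 (abs_inner_defMap_cube_le hx)).2
  nlinarith [sq_nonneg ‖defMap x‖]

/-- Near the Stiefel manifold, the infeasibility is controlled by the gradient of the penalized
function. -/
theorem norm_defMap_le_of_penalized {x u : Mat d r} {B C ρ : ℝ} (hx : ‖defMap x‖ ≤ 1 / 2)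
    (hxC : ‖x‖ ≤ C) (hu : ‖u‖ ≤ B) (hρ : 6 * (C * B) ≤ ρ) :
    ρ * ‖defMap x‖ ≤ 6 * ‖gradDissolve x u + (ρ / 2) • gradDefMap x (defMap x)‖ := by
  have hB0 : 0 ≤ B := (norm_nonneg _).trans hu
  have hC0 : 0 ≤ C := (norm_nonneg _).trans hxC
  set q := gradDissolve x u + (ρ / 2) • gradDefMap x (defMap x) with hq
  set s := msym (mmul (mtr x) u) with hs
  have hs_le : ‖s‖ ≤ C * B :=
    (norm_msym_le _).trans ((norm_mmul_le _ _).trans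
      (by rw [norm_mtr]; exact mul_le_mul hxC hu (norm_nonneg _) hC0))
  -- Against the direction `x c(x)` the first-order terms `⟨c, s⟩` cancel and only terms quadratic
  -- in `c` survive. They cost at most `3/2 C B ‖c‖² ≤ ρ/4 ‖c‖²`, while the penalty contributes at
  -- least `ρ/2 ‖c‖²`.
  have e : ⟪mmul x (defMap x), q⟫ = -(1 / 2) * ⟪mmul x (defMap x), mmul u (defMap x)⟫
      - ⟪defMap x, mmul (defMap x) s⟫ + ρ * ‖mmul x (defMap x)‖ ^ 2 := by
    have e1 : ⟪mmul x (defMap x), u⟫ = ⟪defMap x, s⟫ := by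
      rw [inner_mmul_left, hs, ← inner_msym_comm, msym_eq_self (mtr_defMap x)]
    have e2 : ⟪mmul x (defMap x), mmul x s⟫ = ⟪defMap x, s⟫ + ⟪defMap x, mmul (defMap x) s⟫ := by
      rw [inner_mmul_left, ← mmul_assoc, mtr_mmul_self, add_mmul, mone_mmul, inner_add_right]
    rw [hq, gradDissolve_eq, gradDefMap_eq, inner_add_right, inner_sub_right, inner_sub_right,
      inner_smul_right, inner_smul_right, inner_smul_right, e1, ← hs, e2,
      real_inner_self_eq_norm_sq]
    ring
  have h1 : ⟪mmul x (defMap x), mmul u (defMap x)⟫ ≤ C * B * ‖defMap x‖ ^ 2 := by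
    refine (real_inner_le_norm _ _).trans ?_
    calc ‖mmul x (defMap x)‖ * ‖mmul u (defMap x)‖
        ≤ (C * ‖defMap x‖) * (B * ‖defMap x‖) := by
          gcongr
          · exact (norm_mmul_le _ _).trans (by gcongr)
          · exact (norm_mmul_le _ _).trans (by gcongr)
      _ = _ := by ring
  have h2 : ⟪defMap x, mmul (defMap x) s⟫ ≤ C * B * ‖defMap x‖ ^ 2 := by
    refine (real_inner_le_norm _ _).trans ?_
    calc ‖defMap x‖ * ‖mmul (defMap x) s‖
        ≤ ‖defMap x‖ * (‖defMap x‖ * (C * B)) := by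
          gcongr
          exact (norm_mmul_le _ _).trans (by gcongr)
      _ = _ := by ring
  have h3 := norm_mmul_defMap_sq x
  have h4 := (abs_le.1 (abs_inner_defMap_cube_le hx)).1
  have h5 := norm_mmul_defMap_le hx
  have h6 := real_inner_le_norm (mmul x (defMap x)) q
  have hρ0 : 0 ≤ ρ := le_trans (by positivity) hρ
  rcases (norm_nonneg (defMap x)).eq_or_lt with h0 | h0
  · rw [← h0, mul_zero]; positivity
  · have h7 : ρ * (1 / 2 * ‖defMap x‖ ^ 2) ≤ ρ * ‖mmul x (defMap x)‖ ^ 2 :=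
      mul_le_mul_of_nonneg_left (by linarith) hρ0
    have h8 : ‖mmul x (defMap x)‖ * ‖q‖ ≤ 3 / 2 * ‖defMap x‖ * ‖q‖ :=
      mul_le_mul_of_nonneg_right h5 (norm_nonneg _)
    have h9 := mul_le_mul_of_nonneg_right hρ (sq_nonneg ‖defMap x‖)
    refine le_of_mul_le_mul_right ?_ h0
    nlinarith

/-- `x` and `u` are exchanged for `U` and `v` one factor at a time, with `c(U) = 0`. Its use: at `U`
on the manifold `gradDissolve` gives the Riemannian gradient. -/
theorem norm_gradDissolve_sub_le {x U u v : Mat d r} {B C : ℝ} (hU : U ∈ stiefel d r)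
    (hxC : ‖x‖ ≤ C) (hUC : ‖U‖ ≤ C) (hu : ‖u‖ ≤ B) :
    ‖gradDissolve x u - gradDissolve U v‖
      ≤ (1 + C ^ 2) * ‖u - v‖ + B / 2 * ‖defMap x‖ + 2 * (C * B) * ‖x - U‖ := by
  have hB0 : 0 ≤ B := (norm_nonneg _).trans hu
  have hC0 : 0 ≤ C := (norm_nonneg _).trans hxC
  have e : gradDissolve x u - gradDissolve U v = (u - v) - (1 / 2 : ℝ) • mmul u (defMap x)
      - mmul (x - U) (msym (mmul (mtr x) u))
      - mmul U (msym (mmul (mtr (x - U)) u)) - mmul U (msym (mmul (mtr U) (u - v))) := by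
    rw [gradDissolve_eq, gradDissolve_eq, show defMap U = 0 from hU, mmul_zero, smul_zero,
      sub_mmul, mtr_sub, sub_mmul, mmul_sub]
    simp only [msym, mtr_sub, smul_add, smul_sub, mmul_add, mmul_sub, mmul_smul]
    module
  have h1 : ‖(1 / 2 : ℝ) • mmul u (defMap x)‖ ≤ B / 2 * ‖defMap x‖ := by
    rw [norm_smul]
    have := norm_mmul_le u (defMap x)
    have h := mul_le_mul_of_nonneg_right hu (norm_nonneg (defMap x))
    norm_num
    linarith
  have h2 : ‖mmul (x - U) (msym (mmul (mtr x) u))‖ ≤ C * B * ‖x - U‖ := by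
    calc _ ≤ ‖x - U‖ * (‖mtr x‖ * ‖u‖) := (norm_mmul_le _ _).trans
            (mul_le_mul_of_nonneg_left ((norm_msym_le _).trans (norm_mmul_le _ _)) (norm_nonneg _))
      _ ≤ ‖x - U‖ * (C * B) := by rw [norm_mtr]; gcongr
      _ = _ := by ring
  have h3 : ‖mmul U (msym (mmul (mtr (x - U)) u))‖ ≤ C * B * ‖x - U‖ := by
    calc _ ≤ ‖U‖ * (‖mtr (x - U)‖ * ‖u‖) := (norm_mmul_le _ _).trans
            (mul_le_mul_of_nonneg_left ((norm_msym_le _).trans (norm_mmul_le _ _)) (norm_nonneg _))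
      _ ≤ C * (‖x - U‖ * B) := by rw [norm_mtr]; gcongr
      _ = _ := by ring
  have h4 : ‖mmul U (msym (mmul (mtr U) (u - v)))‖ ≤ C ^ 2 * ‖u - v‖ := by
    calc _ ≤ ‖U‖ * (‖mtr U‖ * ‖u - v‖) := (norm_mmul_le _ _).trans
            (mul_le_mul_of_nonneg_left ((norm_msym_le _).trans (norm_mmul_le _ _)) (norm_nonneg _))
      _ ≤ C * (C * ‖u - v‖) := by rw [norm_mtr]; gcongr
      _ = _ := by ring
  rw [e]
  have k1 := norm_sub_le ((u - v) - (1 / 2 : ℝ) • mmul u (defMap x)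
      - mmul (x - U) (msym (mmul (mtr x) u)) - mmul U (msym (mmul (mtr (x - U)) u)))
      (mmul U (msym (mmul (mtr U) (u - v))))
  have k2 := norm_sub_le ((u - v) - (1 / 2 : ℝ) • mmul u (defMap x)
      - mmul (x - U) (msym (mmul (mtr x) u))) (mmul U (msym (mmul (mtr (x - U)) u)))
  have k3 := norm_sub_le ((u - v) - (1 / 2 : ℝ) • mmul u (defMap x))
    (mmul (x - U) (msym (mmul (mtr x) u)))
  have k4 := norm_sub_le (u - v) ((1 / 2 : ℝ) • mmul u (defMap x))
  linarith

theorem riemGradX_eq_gradDissolve {m : ℕ} (f : Mat d r → Vec m → ℝ) {U : Mat d r} (y : Vec m)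
    (hU : U ∈ stiefel d r) : riemGradX f U y = gradDissolve U (gradX f U y) := by
  rw [riemGradX_eq f U y hU, gradDissolve_eq, show defMap U = 0 from hU, mmul_zero, smul_zero,
    sub_zero]
  rfl

theorem norm_dissolve_sub_le {x U : Mat d r} {C : ℝ} (hxC : ‖x‖ ≤ C)
    (hxU : ‖x - U‖ ≤ ‖defMap x‖) : ‖dissolve x - U‖ ≤ (1 + C / 2) * ‖defMap x‖ := by
  have h := norm_sub_le (x - U) ((1 / 2 : ℝ) • mmul x (defMap x))
  have h1 : ‖(1 / 2 : ℝ) • mmul x (defMap x)‖ ≤ C / 2 * ‖defMap x‖ := by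
    rw [norm_smul]
    have := norm_mmul_le x (defMap x)
    have h := mul_le_mul_of_nonneg_right hxC (norm_nonneg (defMap x))
    norm_num
    linarith
  rw [dissolve_eq, sub_right_comm]
  linarith

end MatrixAlgebra

/-! ### An abstract minimax game: error bounds and descent of the potential. -/

section Abstract

variable {E G : Type*} [NormedAddCommGroup E] [InnerProductSpace ℝ E]
  [NormedAddCommGroup G] [InnerProductSpace ℝ G]

/-- Divide by `s` and let `s → 0`; one explicit small `s` suffices. It turns minimality along
segments into first-order conditions. -/
theorem nonneg_of_forall_segment {A B : ℝ}
    (h : ∀ s : ℝ, 0 < s → s ≤ 1 → 0 ≤ s * A + s ^ 2 * B) : 0 ≤ A := by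
  by_contra hA
  push Not at hA
  have hB : 0 < |B| + 1 := by positivity
  set s := min 1 (-A / (2 * (|B| + 1))) with hs
  have hq : 0 < -A / (2 * (|B| + 1)) := div_pos (by linarith) (by linarith)
  have hs0 : 0 < s := lt_min one_pos hq
  have h1 := h s hs0 (min_le_left _ _)
  have h2 : s * (|B| + 1) ≤ -A / 2 := by
    have := min_le_right 1 (-A / (2 * (|B| + 1)))
    rw [le_div_iff₀ (by positivity)] at this
    linarith
  have h3 : 0 ≤ A + s * B := by
    by_contra hc
    push Not at hc
    nlinarith
  nlinarith [le_abs_self B]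

/-- Quadratic growth at a minimizer of a weakly convex function plus a quadratic. -/
theorem quadratic_growth {X : Set E} (hX : Convex ℝ X) {q : E → ℝ} {κ p : ℝ}
    (hq : ∀ a ∈ X, ∀ b ∈ X, ∀ s : ℝ, 0 ≤ s → s ≤ 1 →
      q (a + s • (b - a)) ≤ (1 - s) * q a + s * q b + κ / 2 * (s * (1 - s)) * ‖b - a‖ ^ 2)
    {z a b : E} (ha : a ∈ X) (hb : b ∈ X)
    (hmin : ∀ x ∈ X, q a + p / 2 * ‖a - z‖ ^ 2 ≤ q x + p / 2 * ‖x - z‖ ^ 2) :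
    q a + p / 2 * ‖a - z‖ ^ 2 + (p - κ) / 2 * ‖b - a‖ ^ 2 ≤ q b + p / 2 * ‖b - z‖ ^ 2 := by
  have key : 0 ≤ (q b - q a + κ / 2 * ‖b - a‖ ^ 2 + p * ⟪a - z, b - a⟫) := by
    refine nonneg_of_forall_segment (B := (p - κ) / 2 * ‖b - a‖ ^ 2) fun s hs0 hs1 => ?_
    have h1 := hmin _ (hX.add_smul_sub_mem ha hb ⟨hs0.le, hs1⟩)
    have h2 := hq a ha b hb s hs0.le hs1
    have h3 : ‖a + s • (b - a) - z‖ ^ 2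
        = ‖a - z‖ ^ 2 + 2 * s * ⟪a - z, b - a⟫ + s ^ 2 * ‖b - a‖ ^ 2 := by
      rw [show a + s • (b - a) - z = (a - z) + s • (b - a) by abel, norm_add_sq_real,
        inner_smul_right, norm_smul, mul_pow, Real.norm_eq_abs, sq_abs]
      ring
    rw [h3] at h1
    nlinarith
  have h4 : ‖b - z‖ ^ 2 = ‖a - z‖ ^ 2 + 2 * ⟪a - z, b - a⟫ + ‖b - a‖ ^ 2 := by
    rw [show b - z = (a - z) + (b - a) by abel, norm_add_sq_real]
  rw [h4]
  nlinarith

/-- A coupling `g` on `X × Y` with partial gradients `gx`, `gy` that are `l`-Lipschitz, together with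
a `ζ`-weakly convex regularizer `η` for which `η - g(x, ·)` satisfies the
Polyak–Łojasiewicz inequality with constant `μ`. -/
structure IsRegularGame (X : Set E) (Y : Set G) (g : E → G → ℝ) (gx : E → G → E) (gy : E → G → G)
    (η : G → ℝ) (l ζ μ : ℝ) : Prop where
  l_pos : 0 < l
  μ_pos : 0 < μ
  ζ_nonneg : 0 ≤ ζ
  isCompact_X : IsCompact X
  convex_X : Convex ℝ X
  nonempty_X : X.Nonempty
  isCompact_Y : IsCompact Y
  convex_Y : Convex ℝ Y
  nonempty_Y : Y.Nonempty
  continuousOn : ContinuousOn η Y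
  taylor_x : ∀ a ∈ X, ∀ b ∈ X, ∀ y ∈ Y,
    |g b y - g a y - ⟪gx a y, b - a⟫| ≤ l / 2 * ‖b - a‖ ^ 2
  taylor_y : ∀ x ∈ X, ∀ a ∈ Y, ∀ b ∈ Y,
    |g x b - g x a - ⟪gy x a, b - a⟫| ≤ l / 2 * ‖b - a‖ ^ 2
  lipschitz_x : ∀ a ∈ X, ∀ b ∈ X, ∀ y ∈ Y, ∀ w ∈ Y,
    ‖gx a y - gx b w‖ ≤ l * ‖a - b‖ + l * ‖y - w‖
  lipschitz_y : ∀ a ∈ X, ∀ b ∈ X, ∀ y ∈ Y, ∀ w ∈ Y,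
    ‖gy a y - gy b w‖ ≤ l * ‖a - b‖ + l * ‖y - w‖
  -- PL tested only on subgradients with a quadratic lower bound of some modulus `κ`; the argument
  -- meets no others.
  pl : ∀ x ∈ X, ∀ y ∈ Y, ∀ s : G, ∀ κ : ℝ,
    (∀ w ∈ Y, η y + ⟪s, w - y⟫ - κ * ‖w - y‖ ^ 2 ≤ η w) →
    ∀ w ∈ Y, 2 * μ * ((g x w - η w) - (g x y - η y)) ≤ ‖s - gy x y‖ ^ 2

/-- The function `g(x, y) + l ‖x - z‖²`. -/
noncomputable def prox2 (g : E → G → ℝ) (l : ℝ) (x : E) (y : G) (z : E) : ℝ :=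
  g x y + 2 * l / 2 * ‖x - z‖ ^ 2

/-- `a` minimizes `prox2 g l · y z` over `X`. -/
def IsInnerMin (X : Set E) (g : E → G → ℝ) (l : ℝ) (y : G) (z a : E) : Prop :=
  a ∈ X ∧ ∀ x ∈ X, prox2 g l a y z ≤ prox2 g l x y z

/-- `(a, y)` is a saddle point of `prox2 g l · · z - η`. -/
def IsSaddle (X : Set E) (Y : Set G) (g : E → G → ℝ) (η : G → ℝ) (l : ℝ) (z a : E) (y : G) :
    Prop :=
  IsInnerMin X g l y z a ∧ y ∈ Y ∧ ∀ w ∈ Y, g a w - η w ≤ g a y - η y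

variable {X : Set E} {Y : Set G} {g : E → G → ℝ} {gx : E → G → E} {gy : E → G → G}
  {η : G → ℝ} {l ζ μ : ℝ}

omit [InnerProductSpace ℝ E] [NormedAddCommGroup G] [InnerProductSpace ℝ G] in
-- Compare through the mixed pair `(xs, ys')`: `xs'` is minimal against `ys'`, and `ys'` is no
-- better than `ys` against `xs`. Only the proximal term is left.
theorem IsSaddle.value_step {z z' xs xs' : E} {ys ys' : G} (hs : IsSaddle X Y g η l z xs ys)
    (hs' : IsSaddle X Y g η l z' xs' ys') :
    (prox2 g l xs' ys' z' - η ys') - (prox2 g l xs ys z - η ys)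
      ≤ l * (‖xs - z'‖ ^ 2 - ‖xs - z‖ ^ 2) := by
  have h1 := hs'.1.2 xs hs.1.1
  have h2 := hs.2.2 ys' hs'.2.1
  unfold prox2 at *
  linarith

omit [InnerProductSpace ℝ E] [NormedAddCommGroup G] [InnerProductSpace ℝ G] in
theorem IsInnerMin.value_step {z z' a a' : E} {y : G} (ha : IsInnerMin X g l y z a)
    (ha' : IsInnerMin X g l y z' a') :
    l * (‖a' - z'‖ ^ 2 - ‖a' - z‖ ^ 2) ≤ prox2 g l a' y z' - prox2 g l a y z := by
  have h1 := ha.2 a' ha'.1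
  unfold prox2 at *
  linarith

namespace IsRegularGame

variable (H : IsRegularGame X Y g gx gy η l ζ μ)
include H

theorem continuousOn_x {y : G} (hy : y ∈ Y) : ContinuousOn (fun x => g x y) X := by
  intro a ha
  have hb : Tendsto (fun b => ⟪gx a y, b - a⟫ + l / 2 * ‖b - a‖ ^ 2) (𝓝[X] a) (𝓝 0) := by
    have : Continuous (fun b => ⟪gx a y, b - a⟫ + l / 2 * ‖b - a‖ ^ 2) := by fun_prop
    simpa using (this.tendsto a).mono_left nhdsWithin_le_nhds
  have hc : Tendsto (fun b => ⟪gx a y, b - a⟫ - l / 2 * ‖b - a‖ ^ 2) (𝓝[X] a) (𝓝 0) := by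
    have : Continuous (fun b => ⟪gx a y, b - a⟫ - l / 2 * ‖b - a‖ ^ 2) := by fun_prop
    simpa using (this.tendsto a).mono_left nhdsWithin_le_nhds
  have : Tendsto (fun b => g b y - g a y) (𝓝[X] a) (𝓝 0) := by
    refine tendsto_of_tendsto_of_tendsto_of_le_of_le' hc hb ?_ ?_
    · filter_upwards [self_mem_nhdsWithin] with b hbX
      have := (abs_le.1 (H.taylor_x a ha b hbX y hy)).1
      linarith
    · filter_upwards [self_mem_nhdsWithin] with b hbX
      have := (abs_le.1 (H.taylor_x a ha b hbX y hy)).2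
      linarith
  exact tendsto_sub_nhds_zero_iff.1 this

theorem continuousOn_y {x : E} (hx : x ∈ X) : ContinuousOn (g x) Y := by
  intro a ha
  have hb : Tendsto (fun b => ⟪gy x a, b - a⟫ + l / 2 * ‖b - a‖ ^ 2) (𝓝[Y] a) (𝓝 0) := by
    have : Continuous (fun b => ⟪gy x a, b - a⟫ + l / 2 * ‖b - a‖ ^ 2) := by fun_prop
    simpa using (this.tendsto a).mono_left nhdsWithin_le_nhds
  have hc : Tendsto (fun b => ⟪gy x a, b - a⟫ - l / 2 * ‖b - a‖ ^ 2) (𝓝[Y] a) (𝓝 0) := by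
    have : Continuous (fun b => ⟪gy x a, b - a⟫ - l / 2 * ‖b - a‖ ^ 2) := by fun_prop
    simpa using (this.tendsto a).mono_left nhdsWithin_le_nhds
  have : Tendsto (fun b => g x b - g x a) (𝓝[Y] a) (𝓝 0) := by
    refine tendsto_of_tendsto_of_tendsto_of_le_of_le' hc hb ?_ ?_
    · filter_upwards [self_mem_nhdsWithin] with b hbX
      have := (abs_le.1 (H.taylor_y x hx a ha b hbX)).1
      linarith
    · filter_upwards [self_mem_nhdsWithin] with b hbX
      have := (abs_le.1 (H.taylor_y x hx a ha b hbX)).2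
      linarith
  exact tendsto_sub_nhds_zero_iff.1 this

theorem exists_isInnerMin {y : G} (hy : y ∈ Y) (z : E) : ∃ a, IsInnerMin X g l y z a := by
  obtain ⟨a, ha, hmin⟩ := H.isCompact_X.exists_isMinOn H.nonempty_X
    (f := fun x => prox2 g l x y z)
    ((H.continuousOn_x hy).add (by fun_prop))
  exact ⟨a, ha, fun x hx => hmin hx⟩

theorem weaklyConvex_x {y : G} (hy : y ∈ Y) : ∀ a ∈ X, ∀ b ∈ X, ∀ s : ℝ, 0 ≤ s → s ≤ 1 →
    g (a + s • (b - a)) y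
      ≤ (1 - s) * g a y + s * g b y + l / 2 * (s * (1 - s)) * ‖b - a‖ ^ 2 := by
  intro a ha b hb s hs0 hs1
  have hm := H.convex_X.add_smul_sub_mem ha hb ⟨hs0, hs1⟩
  set m := a + s • (b - a) with hmdef
  have h1 := (abs_le.1 (H.taylor_x m hm a ha y hy)).1
  have h2 := (abs_le.1 (H.taylor_x m hm b hb y hy)).1
  have e1 : a - m = (-s) • (b - a) := by rw [hmdef]; module
  have e2 : b - m = (1 - s) • (b - a) := by rw [hmdef]; module
  rw [e1, inner_smul_right, norm_smul, mul_pow, Real.norm_eq_abs, sq_abs] at h1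
  rw [e2, inner_smul_right, norm_smul, mul_pow, Real.norm_eq_abs, sq_abs] at h2
  nlinarith [mul_le_mul_of_nonneg_left h1 (sub_nonneg.2 hs1), mul_le_mul_of_nonneg_left h2 hs0]

/-- `g(·, y)` is `l`-weakly convex and the proximal term has weight `2l`, so strong convexity with
modulus `l` remains. -/
theorem growth {y : G} (hy : y ∈ Y) {z a b : E} (ha : IsInnerMin X g l y z a) (hb : b ∈ X) :
    prox2 g l a y z + l / 2 * ‖b - a‖ ^ 2 ≤ prox2 g l b y z := by
  have := quadratic_growth H.convex_X (q := fun x => g x y) (p := 2 * l) (z := z)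
    (H.weaklyConvex_x hy) ha.1 hb
    (fun x hx => ha.2 x hx)
  unfold prox2
  linarith

/-- Error bound: the distance to the inner minimizer is controlled by the distance between the
gradient and the negative normal cone. -/
theorem error_bound {y : G} (hy : y ∈ Y) {z a b v : E} (ha : IsInnerMin X g l y z a) (hb : b ∈ X)
    (hv : ∀ u ∈ X, 0 ≤ ⟪v, u - b⟫) :
    l * ‖b - a‖ ≤ ‖gx b y + (2 * l) • (b - z) - v‖ := by
  -- Growth at `a` gives `l/2`; Taylor at `b` together with the proximal square gives `l - l/2`.
  -- Together the gradient is strongly monotone with modulus `l`.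
  have h1 := H.growth hy ha hb
  have h2 := (abs_le.1 (H.taylor_x b hb a ha.1 y hy)).1
  have h3 := hv a ha.1
  have e : ‖a - z‖ ^ 2 = ‖b - z‖ ^ 2 + 2 * ⟪b - z, a - b⟫ + ‖a - b‖ ^ 2 := by
    rw [show a - z = (b - z) + (a - b) by abel, norm_add_sq_real]
  unfold prox2 at h1
  rw [norm_sub_rev a b] at e h2
  rw [e] at h1
  have h4 : ⟪gx b y + (2 * l) • (b - z) - v, b - a⟫
      = -⟪gx b y, a - b⟫ - 2 * l * ⟪b - z, a - b⟫ + ⟪v, a - b⟫ := by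
    rw [← neg_sub a b, inner_neg_right, inner_sub_left, inner_add_left, inner_smul_left]
    simp
    ring
  have h5 := real_inner_le_norm (gx b y + (2 * l) • (b - z) - v) (b - a)
  rcases (norm_nonneg (b - a)).eq_or_lt with h0 | h0
  · rw [← h0]; simp
  · refine le_of_mul_le_mul_right ?_ h0
    nlinarith

theorem variational {y : G} (hy : y ∈ Y) {z a : E} (ha : IsInnerMin X g l y z a) :
    ∀ u ∈ X, 0 ≤ ⟪gx a y + (2 * l) • (a - z), u - a⟫ := by
  intro u hu
  refine nonneg_of_forall_segment (B := 3 * l / 2 * ‖u - a‖ ^ 2) fun s hs0 hs1 => ?_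
  have hm := H.convex_X.add_smul_sub_mem ha.1 hu ⟨hs0.le, hs1⟩
  have h1 := ha.2 _ hm
  have h2 := (abs_le.1 (H.taylor_x a ha.1 _ hm y hy)).2
  have e : ‖a + s • (u - a) - z‖ ^ 2
        = ‖a - z‖ ^ 2 + 2 * s * ⟪a - z, u - a⟫ + s ^ 2 * ‖u - a‖ ^ 2 := by
      rw [show a + s • (u - a) - z = (a - z) + s • (u - a) by abel, norm_add_sq_real,
        inner_smul_right, norm_smul, mul_pow, Real.norm_eq_abs, sq_abs]
      ring
  unfold prox2 at h1
  rw [add_sub_cancel_left, inner_smul_right, norm_smul, mul_pow, Real.norm_eq_abs, sq_abs] at h2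
  rw [e] at h1
  rw [inner_add_left, inner_smul_left]
  simp only [conj_trivial]
  nlinarith

/-- The minimizer for `w` solves the problem for `y` up to a gradient error `l ‖w - y‖`, so
`error_bound` applies with its own gradient as `v`. -/
theorem innerMin_lipschitz_y {y w : G} (hy : y ∈ Y) (hw : w ∈ Y) {z a b : E}
    (ha : IsInnerMin X g l y z a) (hb : IsInnerMin X g l w z b) : ‖b - a‖ ≤ ‖w - y‖ := by
  have h := H.error_bound hy ha hb.1 (H.variational hw hb)
  have h2 := H.lipschitz_x b hb.1 b hb.1 y hy w hw
  rw [add_sub_add_right_eq_sub] at h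
  rw [sub_self, norm_zero, mul_zero, zero_add, norm_sub_rev y w] at h2
  exact le_of_mul_le_mul_left (h.trans h2) H.l_pos

theorem innerMin_lipschitz_z {y : G} (hy : y ∈ Y) {z z' a b : E}
    (ha : IsInnerMin X g l y z a) (hb : IsInnerMin X g l y z' b) : ‖b - a‖ ≤ 2 * ‖z' - z‖ := by
  have h := H.error_bound hy ha hb.1 (H.variational hy hb)
  rw [add_sub_add_left_eq_sub, ← smul_sub, sub_sub_sub_cancel_left, norm_smul, Real.norm_eq_abs,
    abs_of_pos (by linarith [H.l_pos])] at h
  refine le_of_mul_le_mul_left (h.trans (le_of_eq ?_)) H.l_pos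
  ring

/-- A quadratic lower bound for the dual function `y ↦ min_x prox2 g l x y z`. -/
theorem dual_lower {y w : G} (hy : y ∈ Y) (hw : w ∈ Y) {z a b : E}
    (ha : IsInnerMin X g l y z a) (hb : IsInnerMin X g l w z b) :
    prox2 g l a y z + ⟪gy a y, w - y⟫ - 3 * l / 2 * ‖w - y‖ ^ 2 ≤ prox2 g l b w z := by
  -- The constant `3l/2` is `l/2` from Taylor at `b` plus `l` for replacing the gradient at `b` by
  -- the one at `a`.
  have h1 := (abs_le.1 (H.taylor_y b hb.1 y hy w hw)).1
  have h2 := ha.2 b hb.1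
  have h3 := H.lipschitz_y a ha.1 b hb.1 y hy y hy
  have h4 := H.innerMin_lipschitz_y hy hw ha hb
  rw [sub_self, norm_zero, mul_zero, add_zero, norm_sub_rev a b] at h3
  have h5 := real_inner_le_norm (gy a y - gy b y) (w - y)
  rw [inner_sub_left] at h5
  have h6 : ‖gy a y - gy b y‖ * ‖w - y‖ ≤ l * ‖w - y‖ ^ 2 := by
    have : ‖gy a y - gy b y‖ ≤ l * ‖w - y‖ :=
      h3.trans (mul_le_mul_of_nonneg_left h4 H.l_pos.le)
    nlinarith [norm_nonneg (w - y)]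
  unfold prox2 at h2 ⊢
  linarith

/-- Strong duality: a maximizer of the dual function and its inner minimizer form a saddle
point. -/
theorem isSaddle_of_dualMax {y : G} (hy : y ∈ Y) {z a : E} (ha : IsInnerMin X g l y z a)
    (hmax : ∀ w ∈ Y, ∀ b, IsInnerMin X g l w z b →
      prox2 g l b w z - η w ≤ prox2 g l a y z - η y) : IsSaddle X Y g η l z a y := by
  refine ⟨ha, hy, fun w hw => ?_⟩
  -- Maximality and `dual_lower` make `gy a y` itself a subgradient of `η` at `y`. For this choice
  -- PL has right-hand side zero, so `y` is a global best response although nothing is concave.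
  have hs : ∀ w ∈ Y, η y + ⟪gy a y, w - y⟫ - 3 * l / 2 * ‖w - y‖ ^ 2 ≤ η w := by
    intro w hw
    obtain ⟨b, hb⟩ := H.exists_isInnerMin hw z
    have h1 := hmax w hw b hb
    have h2 := H.dual_lower hy hw ha hb
    linarith
  have h := H.pl a ha.1 y hy (gy a y) _ hs w hw
  rw [sub_self, norm_zero] at h
  have := H.μ_pos
  by_contra hc
  push Not at hc
  nlinarith

/-- The dual function is a minimum of functions continuous in `y`, hence upper semicontinuous, and
attains its maximum on the compact `Y`. -/
theorem exists_isSaddle (z : E) : ∃ a y, IsSaddle X Y g η l z a y := by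
  have hex : ∀ y, ∃ a, y ∈ Y → IsInnerMin X g l y z a := by
    intro y
    by_cases hy : y ∈ Y
    · obtain ⟨a, ha⟩ := H.exists_isInnerMin hy z
      exact ⟨a, fun _ => ha⟩
    · exact ⟨0, fun h => (hy h).elim⟩
  choose m hm using hex
  have husc : UpperSemicontinuousOn (fun y => prox2 g l (m y) y z - η y) Y := by
    intro y hy c hc
    have hcont : ContinuousOn (fun w => prox2 g l (m y) w z - η w) Y :=
      ((H.continuousOn_y (hm y hy).1).add continuousOn_const).sub H.continuousOn
    have h1 := (hcont y hy).eventually_lt_const hc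
    filter_upwards [h1, self_mem_nhdsWithin] with w hw hwY
    have := (hm w hwY).2 (m y) (hm y hy).1
    linarith
  obtain ⟨y, hy, hmax⟩ := husc.exists_isMaxOn H.nonempty_Y H.isCompact_Y
  refine ⟨m y, y, H.isSaddle_of_dualMax hy (hm y hy) fun w hw b hb => ?_⟩
  have h1 := hmax hw
  have h2 := hb.2 _ (hm w hw).1
  simp only [mem_ofPred_eq] at h1
  linarith

/-- The inner minimizer is close to the saddle point when the dual residual is small. -/
theorem saddle_error_bound {y : G} (hy : y ∈ Y) {z a xs : E} {ys s : G} {κ : ℝ}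
    (ha : IsInnerMin X g l y z a) (hsad : IsSaddle X Y g η l z xs ys)
    (hs : ∀ w ∈ Y, η y + ⟪s, w - y⟫ - κ * ‖w - y‖ ^ 2 ≤ η w) :
    l * μ * ‖a - xs‖ ^ 2 ≤ ‖s - gy a y‖ ^ 2 := by
  -- PL bounds the gain of `ys` over `y` against `a`. That gain is at least `l/2 ‖a - xs‖²`, by
  -- growth around `xs` and the optimality of `ys` and `a`.
  have h1 := H.pl a ha.1 y hy s κ hs ys hsad.2.1
  have h2 := H.growth hsad.2.1 hsad.1 ha.1
  have h3 := hsad.2.2 y hy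
  have h4 := ha.2 xs hsad.1.1
  have := H.μ_pos
  unfold prox2 at *
  nlinarith

/-- Testing the variational inequality at `x` gains `T ‖x' - x‖²`; smoothness and the proximal term
give back `3l/2`, at most half of `T`. -/
theorem potential_step_x {T : ℝ} (hT : 3 * l ≤ T) {x x' z : E} {y : G} (hx : x ∈ X)
    (hx' : x' ∈ X) (hy : y ∈ Y)
    (hVI : ∀ u ∈ X, 0 ≤ ⟪gx x y + (2 * l) • (x - z) + T • (x' - x), u - x'⟫) :
    prox2 g l x' y z + T / 2 * ‖x' - x‖ ^ 2 ≤ prox2 g l x y z := by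
  have h1 := (abs_le.1 (H.taylor_x x hx x' hx' y hy)).2
  have h2 := hVI x hx
  have e : ‖x' - z‖ ^ 2 = ‖x - z‖ ^ 2 + 2 * ⟪x - z, x' - x⟫ + ‖x' - x‖ ^ 2 := by
    rw [show x' - z = (x - z) + (x' - x) by abel, norm_add_sq_real]
  rw [← neg_sub x' x, inner_neg_right, inner_add_left, inner_add_left, inner_smul_left,
    inner_smul_left, real_inner_self_eq_norm_sq] at h2
  simp only [conj_trivial] at h2
  unfold prox2
  rw [e]
  nlinarith [sq_nonneg ‖x' - x‖]

/-- Apply `error_bound` at `x'` with the displaced gradient as `v`; the discrepancy has coefficient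
`l + (T - 2l) ≤ T`. -/
theorem projected_step_error {T : ℝ} (hT : 3 * l ≤ T) {x x' z a : E} {y : G} (hx : x ∈ X)
    (hx' : x' ∈ X) (hy : y ∈ Y) (ha : IsInnerMin X g l y z a)
    (hVI : ∀ u ∈ X, 0 ≤ ⟪gx x y + (2 * l) • (x - z) + T • (x' - x), u - x'⟫) :
    l * ‖x' - a‖ ≤ T * ‖x' - x‖ := by
  have h := H.error_bound hy ha hx' hVI
  have e : gx x' y + (2 * l) • (x' - z) - (gx x y + (2 * l) • (x - z) + T • (x' - x))
      = (gx x' y - gx x y) - (T - 2 * l) • (x' - x) := by module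
  rw [e] at h
  have h1 := norm_sub_le (gx x' y - gx x y) ((T - 2 * l) • (x' - x))
  have h2 := H.lipschitz_x x' hx' x hx y hy y hy
  have hl := H.l_pos
  rw [norm_smul, Real.norm_eq_abs, abs_of_pos (by linarith)] at h1
  rw [sub_self, norm_zero, mul_zero, add_zero] at h2
  nlinarith [norm_nonneg (x' - x)]

/-- With weight 2 on the dual value the first-order terms combine to `2⟨gy x' y - gy a y, y' - y⟩`,
small because `x'` is near `a`. The proximal gain `(48T + 16ζ) ‖y' - y‖²`, with `48T + 16ζ = 1/τ₂`,
pays for this and for the curvature `7l/2 + ζ/2`. -/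
theorem potential_step_y {T : ℝ} (hT : 3 * l ≤ T) {x x' z a a' : E} {y y' : G} (hx : x ∈ X)
    (hx' : x' ∈ X) (hy : y ∈ Y) (hy' : y' ∈ Y)
    (hVI : ∀ u ∈ X, 0 ≤ ⟪gx x y + (2 * l) • (x - z) + T • (x' - x), u - x'⟫)
    (hprox : ∀ w ∈ Y, η y' + ⟪gy x' y - (48 * T + 16 * ζ) • (y' - y), w - y'⟫
      - ζ / 2 * ‖w - y'‖ ^ 2 ≤ η w)
    (ha : IsInnerMin X g l y z a) (ha' : IsInnerMin X g l y' z a') :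
    (prox2 g l x' y' z - η y') - 2 * (prox2 g l a' y' z - η y')
      + (48 * T + 16 * ζ) / 2 * ‖y' - y‖ ^ 2
    ≤ (prox2 g l x' y z - η y) - 2 * (prox2 g l a y z - η y) + T / 4 * ‖x' - x‖ ^ 2 := by
  have h1 := hprox y hy
  have h2 := H.dual_lower hy hy' ha ha'
  have h3 := (abs_le.1 (H.taylor_y x' hx' y hy y' hy')).2
  have h4 := H.lipschitz_y x' hx' a ha.1 y hy y hy
  have h5 := H.projected_step_error hT hx hx' hy ha hVI
  have h6 := real_inner_le_norm (gy x' y - gy a y) (y' - y)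
  have hl := H.l_pos
  have hζ := H.ζ_nonneg
  rw [sub_self, norm_zero, mul_zero, add_zero] at h4
  rw [inner_sub_left] at h6
  rw [← neg_sub y' y, inner_neg_right, inner_sub_left, inner_smul_left, norm_neg,
    real_inner_self_eq_norm_sq] at h1
  simp only [conj_trivial] at h1
  have h7 : ‖gy x' y - gy a y‖ * ‖y' - y‖ ≤ T * ‖x' - x‖ * ‖y' - y‖ :=
    mul_le_mul_of_nonneg_right (h4.trans h5) (norm_nonneg _)
  have h8 : 2 * (T * ‖x' - x‖ * ‖y' - y‖) ≤ T / 4 * ‖x' - x‖ ^ 2 + 4 * T * ‖y' - y‖ ^ 2 := by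
    nlinarith [mul_nonneg (by linarith : 0 ≤ T) (sq_nonneg (‖x' - x‖ - 4 * ‖y' - y‖))]
  have h9 : (7 / 2 * l + ζ / 2 + 4 * T) * ‖y' - y‖ ^ 2
      ≤ (48 * T + 16 * ζ) / 2 * ‖y' - y‖ ^ 2 :=
    mul_le_mul_of_nonneg_right (by linarith) (sq_nonneg _)
  have h10 : prox2 g l x' y' z - prox2 g l x' y z = g x' y' - g x' y := by unfold prox2; ring
  linarith

theorem dual_residual_bound {T : ℝ} (hT : 3 * l ≤ T) {x x' z a a' : E} {y y' : G} (hx : x ∈ X)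
    (hx' : x' ∈ X) (hy : y ∈ Y) (hy' : y' ∈ Y)
    (hVI : ∀ u ∈ X, 0 ≤ ⟪gx x y + (2 * l) • (x - z) + T • (x' - x), u - x'⟫)
    (ha : IsInnerMin X g l y z a) (ha' : IsInnerMin X g l y' z a') :
    ‖gy x' y - (48 * T + 16 * ζ) • (y' - y) - gy a' y'‖
      ≤ T * ‖x' - x‖ + 2 * (48 * T + 16 * ζ) * ‖y' - y‖ := by
  have hl := H.l_pos
  have hζ := H.ζ_nonneg
  have h1 := H.lipschitz_y x' hx' a' ha'.1 y hy y' hy'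
  have h2 := norm_sub_le (gy x' y - gy a' y') ((48 * T + 16 * ζ) • (y' - y))
  have h3 := H.projected_step_error hT hx hx' hy ha hVI
  have h4 := H.innerMin_lipschitz_y hy hy' ha ha'
  have h5 := norm_sub_le_norm_sub_add_norm_sub x' a a'
  rw [norm_sub_rev a a'] at h5
  rw [norm_smul, Real.norm_eq_abs, abs_of_nonneg (by linarith)] at h2
  rw [norm_sub_rev y y'] at h1
  rw [sub_right_comm]
  have h6 : l * ‖x' - a'‖ ≤ T * ‖x' - x‖ + l * ‖y' - y‖ := by nlinarith
  have h7 : 2 * l * ‖y' - y‖ ≤ (48 * T + 16 * ζ) * ‖y' - y‖ :=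
    mul_le_mul_of_nonneg_right (by linarith) (norm_nonneg _)
  linarith

/-- The squares `‖z' - z‖²` cancel between dual value and saddle value, leaving the drift `4l⟨a' -
xs, z' - z⟩`. Young's inequality splits it, and `β ≤ 1/32` absorbs the motion from `a` to `a'`. -/
theorem potential_step_z {β : ℝ} (hβ₀ : 0 < β) (hβ₁ : β ≤ 1 / 32) {x z z' : E} {y : G}
    (hy : y ∈ Y) (hz : z' = z + β • (x - z)) {a a' : E} (ha : IsInnerMin X g l y z a)
    (ha' : IsInnerMin X g l y z' a') {xs xs' : E} {ys ys' : G}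
    (hs : IsSaddle X Y g η l z xs ys) (hs' : IsSaddle X Y g η l z' xs' ys') :
    (prox2 g l x y z' - η y) - 2 * (prox2 g l a' y z' - η y) + 2 * (prox2 g l xs' ys' z' - η ys')
      + l * β / 2 * ‖x - z‖ ^ 2
    ≤ (prox2 g l x y z - η y) - 2 * (prox2 g l a y z - η y) + 2 * (prox2 g l xs ys z - η ys)
      + 16 * l * β * ‖a - xs‖ ^ 2 := by
  have hl := H.l_pos
  have h1 := hs.value_step hs'
  have h2 := ha.value_step ha'
  have h3 := H.innerMin_lipschitz_z hy ha ha'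
  have hzz : z' - z = β • (x - z) := by rw [hz, add_sub_cancel_left]
  have hn : ‖z' - z‖ = β * ‖x - z‖ := by rw [hzz, norm_smul, Real.norm_eq_abs, abs_of_pos hβ₀]
  have e : ∀ v : E, ‖v - z'‖ ^ 2 - ‖v - z‖ ^ 2 = ‖z' - z‖ ^ 2 - 2 * ⟪v - z, z' - z⟫ := by
    intro v
    rw [show v - z' = (v - z) - (z' - z) by abel, norm_sub_sq_real]
    ring
  have e1 : prox2 g l x y z' - prox2 g l x y z = l * (‖x - z'‖ ^ 2 - ‖x - z‖ ^ 2) := by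
    unfold prox2; ring
  have e2 : ⟪x - z, z' - z⟫ = β * ‖x - z‖ ^ 2 := by
    rw [hzz, inner_smul_right, real_inner_self_eq_norm_sq]
  have h4 : ⟪a' - z, z' - z⟫ - ⟪xs - z, z' - z⟫ ≤ ‖a' - xs‖ * ‖z' - z‖ := by
    rw [← inner_sub_left, sub_sub_sub_cancel_right]
    exact real_inner_le_norm _ _
  have h5 := norm_sub_le_norm_sub_add_norm_sub a' a xs
  rw [e] at h1 h2 e1
  rw [e2, hn] at e1
  rw [hn] at h1 h2 h3 h4
  set n := ‖x - z‖
  set e' := ‖a - xs‖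
  have hn0 : 0 ≤ n := norm_nonneg _
  have h6 : ‖a' - xs‖ * (β * n) ≤ (2 * (β * n) + e') * (β * n) :=
    mul_le_mul_of_nonneg_right (by linarith) (by positivity)
  have h7 : 4 * l * ((2 * (β * n) + e') * (β * n)) ≤ l * β / 2 * n ^ 2 + 16 * l * β * e' ^ 2 := by
    have : 4 * ((2 * (β * n) + e') * n) ≤ 1 / 2 * n ^ 2 + 16 * e' ^ 2 := by
      nlinarith [sq_nonneg (n - 8 * e'), sq_nonneg n, sq_nonneg e',
        mul_nonneg (sub_nonneg.2 hβ₁) (sq_nonneg n)]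
    nlinarith [mul_le_mul_of_nonneg_left this (mul_pos hl hβ₀).le]
  have h8 : l * (β ^ 2 * n ^ 2) ≤ l * β * n ^ 2 := by
    have : 0 ≤ l * β * n ^ 2 := by positivity
    nlinarith
  have h9 : l * (‖a' - xs‖ * (β * n)) ≤ l * ((2 * (β * n) + e') * (β * n)) :=
    mul_le_mul_of_nonneg_left h6 hl.le
  have h10 : l * (⟪a' - z, z' - z⟫ - ⟪xs - z, z' - z⟫) ≤ l * (‖a' - xs‖ * (β * n)) :=
    mul_le_mul_of_nonneg_left h4 hl.le
  nlinarith

/-- One iteration of smoothed gradient descent ascent decreases the potential. -/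
theorem potential_step {α T : ℝ} (hα₀ : 0 < α) (hα₁ : α < 1 / 2306) (hT : 3 * l ≤ T)
    {x x' z z' : E} {y y' : G} (hx : x ∈ X) (hx' : x' ∈ X) (hy : y ∈ Y) (hy' : y' ∈ Y)
    (hVI : ∀ u ∈ X, 0 ≤ ⟪gx x y + (2 * l) • (x - z) + T • (x' - x), u - x'⟫)
    (hprox : ∀ w ∈ Y, η y' + ⟪gy x' y - (48 * T + 16 * ζ) • (y' - y), w - y'⟫
      - ζ / 2 * ‖w - y'‖ ^ 2 ≤ η w)
    {β : ℝ} (hβ : β * (48 * T + 16 * ζ) = α * min μ l) (hz : z' = z + β • (x' - z))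
    {a a' : E} (ha : IsInnerMin X g l y z a) (ha' : IsInnerMin X g l y' z' a')
    {xs xs' : E} {ys ys' : G} (hs : IsSaddle X Y g η l z xs ys)
    (hs' : IsSaddle X Y g η l z' xs' ys') :
    (prox2 g l x' y' z' - η y') - 2 * (prox2 g l a' y' z' - η y')
        + 2 * (prox2 g l xs' ys' z' - η ys')
      + (T / 8 * ‖x' - x‖ ^ 2 + (48 * T + 16 * ζ) / 8 * ‖y' - y‖ ^ 2 + l * β / 4 * ‖x' - z‖ ^ 2)
    ≤ (prox2 g l x y z - η y) - 2 * (prox2 g l a y z - η y) + 2 * (prox2 g l xs ys z - η ys) := by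
  have hl := H.l_pos
  have hμ := H.μ_pos
  have hζ := H.ζ_nonneg
  have hR : 0 < 48 * T + 16 * ζ := by linarith
  have hmin : 0 < min μ l := lt_min hμ hl
  have hβ₀ : 0 < β := by
    by_contra hc
    push Not at hc
    nlinarith [mul_pos hα₀ hmin]
  have hβ₁ : β ≤ 1 / 32 := by
    have h1 : α * min μ l ≤ 1 * l := mul_le_mul (by linarith) (min_le_right _ _) hmin.le one_pos.le
    by_contra hc
    push Not at hc
    nlinarith
  obtain ⟨b, hb⟩ := H.exists_isInnerMin hy' z
  have h1 := H.potential_step_x hT hx hx' hy hVI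
  have h2 := H.potential_step_y hT hx hx' hy hy' hVI hprox ha hb
  have h3 := H.potential_step_z hβ₀ hβ₁ hy' hz hb ha' hs hs'
  have h4 := H.saddle_error_bound hy' hb hs (s := gy x' y - (48 * T + 16 * ζ) • (y' - y))
    (κ := ζ / 2) hprox
  have h5 := H.dual_residual_bound (ζ := ζ) hT hx hx' hy hy' hVI ha hb
  set R := 48 * T + 16 * ζ with hRdef
  set A := ‖x' - x‖
  set B := ‖y' - y‖
  set e := ‖b - xs‖
  have h6 : l * μ * e ^ 2 ≤ 2 * T ^ 2 * A ^ 2 + 8 * R ^ 2 * B ^ 2 := by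
    have := pow_le_pow_left₀ (norm_nonneg _) h5 2
    nlinarith [sq_nonneg (T * A - 2 * R * B)]
  -- The choice of `β` trades `R β` for `α min μ l`, which is what `l μ ‖b - xs‖²` can control.
  have h7 : R * (l * β * e ^ 2) ≤ α * (2 * T ^ 2 * A ^ 2 + 8 * R ^ 2 * B ^ 2) := by
    have e1 : R * (l * β * e ^ 2) = α * (l * min μ l * e ^ 2) := by
      calc R * (l * β * e ^ 2) = (β * R) * (l * e ^ 2) := by ring
        _ = _ := by rw [hβ]; ring
    rw [e1]
    refine mul_le_mul_of_nonneg_left (le_trans ?_ h6) hα₀.le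
    gcongr
    exact min_le_left _ _
  -- Budget: `T/2 - T/4 - T/8` for `x` and `R/2 - 3R/8` for `y`. This needs `α ≤ 3/16` and `α ≤
  -- 3/1024`, both implied by `α < 1/2306`.
  have h8 : 16 * l * β * e ^ 2 ≤ T / 8 * A ^ 2 + 3 * R / 8 * B ^ 2 := by
    refine le_of_mul_le_mul_left ?_ hR
    have k1 : 16 * α * (2 * T ^ 2 * A ^ 2) ≤ R * (T / 8 * A ^ 2) := by
      have : 16 * α * 2 * T ≤ R / 8 := by nlinarith
      have h0 : 0 ≤ T * A ^ 2 := mul_nonneg (by linarith) (sq_nonneg _)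
      linarith [mul_le_mul_of_nonneg_right this h0]
    have k2 : 16 * α * (8 * R ^ 2 * B ^ 2) ≤ R * (3 * R / 8 * B ^ 2) := by
      have h0 : 0 ≤ R ^ 2 * B ^ 2 := by positivity
      linarith [mul_le_mul_of_nonneg_right hα₁.le h0]
    linarith
  have h9 : 0 ≤ l * β * ‖x' - z‖ ^ 2 := by positivity
  linarith

end IsRegularGame

end Abstract

/-! ### Summing the decrease along a trajectory. -/

section Trajectory

variable {E G : Type*} [NormedAddCommGroup E] [InnerProductSpace ℝ E]
  [NormedAddCommGroup G] [InnerProductSpace ℝ G]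
  {X : Set E} {Y : Set G} {g : E → G → ℝ} {gx : E → G → E} {gy : E → G → G}
  {η : G → ℝ} {l ζ μ : ℝ}

/-- A trajectory of smoothed projected gradient descent ascent, described by the optimality
conditions of its projection and proximal steps. -/
structure IsTrajectory (X : Set E) (Y : Set G) (gx : E → G → E) (gy : E → G → G) (η : G → ℝ)
    (l ζ T β : ℝ) (x : ℕ → E) (y : ℕ → G) (z : ℕ → E) : Prop where
  mem_X : ∀ t, x t ∈ X
  mem_Y : ∀ t, y t ∈ Y
  variational : ∀ t, ∀ u ∈ X,
    0 ≤ ⟪gx (x t) (y t) + (2 * l) • (x t - z t) + T • (x (t + 1) - x t), u - x (t + 1)⟫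
  prox : ∀ t, ∀ w ∈ Y, η (y (t + 1))
    + ⟪gy (x (t + 1)) (y t) - (48 * T + 16 * ζ) • (y (t + 1) - y t), w - y (t + 1)⟫
      - ζ / 2 * ‖w - y (t + 1)‖ ^ 2 ≤ η w
  average : ∀ t, z (t + 1) = z t + β • (x (t + 1) - z t)

/-- The guaranteed decrease of the potential in one iteration. -/
noncomputable def decrease (l ζ T β : ℝ) (x : ℕ → E) (y : ℕ → G) (z : ℕ → E) (t : ℕ) : ℝ :=
  T / 8 * ‖x (t + 1) - x t‖ ^ 2 + (48 * T + 16 * ζ) / 8 * ‖y (t + 1) - y t‖ ^ 2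
    + l * β / 4 * ‖x (t + 1) - z t‖ ^ 2

theorem IsRegularGame.sum_decrease_le (H : IsRegularGame X Y g gx gy η l ζ μ) {α T β : ℝ}
    (hα₀ : 0 < α) (hα₁ : α < 1 / 2306) (hT : 3 * l ≤ T)
    (hβ : β * (48 * T + 16 * ζ) = α * min μ l) {x : ℕ → E} {y : ℕ → G} {z : ℕ → E}
    (htr : IsTrajectory X Y gx gy η l ζ T β x y z)
    (hy₀ : ∀ a, IsInnerMin X g l (y 0) (z 0) a → ∀ w ∈ Y, ∀ b, IsInnerMin X g l w (z 0) b →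
      prox2 g l b w (z 0) - η w ≤ prox2 g l a (y 0) (z 0) - η (y 0))
    {L B : ℝ}
    (hL : ∀ a ∈ X, ∀ v ∈ Y, (∀ w ∈ Y, g a w - η w ≤ g a v - η v) → L ≤ g a v - η v)
    (hB : prox2 g l (x 0) (y 0) (z 0) - η (y 0) ≤ B) :
    (∀ N, ∑ t ∈ Finset.range N, decrease l ζ T β x y z t ≤ B - L) ∧
      ∀ t, g (x t) (y t) - η (y t) ≤ B := by
  have hl := H.l_pos
  have hζ := H.ζ_nonneg
  have hmin : 0 < min μ l := lt_min H.μ_pos hl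
  have hβ₀ : 0 < β := by
    by_contra hc
    push Not at hc
    nlinarith [mul_pos hα₀ hmin]
  choose a ha using fun t => H.exists_isInnerMin (htr.mem_Y t) (z t)
  choose xs ys hs using fun t => H.exists_isSaddle (z t)
  set V : ℕ → ℝ := fun t => (prox2 g l (x t) (y t) (z t) - η (y t))
    - 2 * (prox2 g l (a t) (y t) (z t) - η (y t)) + 2 * (prox2 g l (xs t) (ys t) (z t) - η (ys t))
    with hV
  have hstep : ∀ t, V (t + 1) + decrease l ζ T β x y z t ≤ V t := fun t =>
    H.potential_step hα₀ hα₁ hT (htr.mem_X t) (htr.mem_X (t + 1)) (htr.mem_Y t)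
      (htr.mem_Y (t + 1)) (htr.variational t) (htr.prox t) hβ (htr.average t) (ha t)
      (ha (t + 1)) (hs t) (hs (t + 1))
  -- As `y 0` maximizes the dual function, its dual value is the saddle value, and the last two
  -- terms of `V 0` cancel.
  have hV₀ : V 0 ≤ B := by
    have h1 := H.isSaddle_of_dualMax (htr.mem_Y 0) (ha 0) (hy₀ (a 0) (ha 0))
    have h2 := (hs 0).1.2 (a 0) (ha 0).1
    have h3 := h1.2.2 (ys 0) (hs 0).2.1
    simp only [hV]
    unfold prox2 at *
    linarith
  have hdec : ∀ t, 0 ≤ decrease l ζ T β x y z t := by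
    intro t
    have hT0 : 0 ≤ T := by linarith
    unfold decrease
    positivity
  have hsum : ∀ N, V N + ∑ t ∈ Finset.range N, decrease l ζ T β x y z t ≤ V 0 := by
    intro N
    induction N with
    | zero => simp
    | succ n ih =>
      rw [Finset.sum_range_succ]
      linarith [hstep n]
  -- Weak duality `Ψ ≤ P` gives `V ≥ φ`; with `Ψ ≤ φ` it also gives `V ≥ P ≥ L`. The first bound
  -- later controls feasibility, the second the iteration count.
  have hlow : ∀ t, prox2 g l (x t) (y t) (z t) - η (y t) ≤ V t ∧ L ≤ V t := by
    intro t
    have h1 := (ha t).2 (x t) (htr.mem_X t)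
    have h2 := (ha t).2 (xs t) (hs t).1.1
    have h3 := (hs t).2.2 (y t) (htr.mem_Y t)
    have h4 := hL (xs t) (hs t).1.1 (ys t) (hs t).2.1 (hs t).2.2
    have h5 : 0 ≤ l * ‖xs t - z t‖ ^ 2 := by positivity
    simp only [hV]
    unfold prox2 at *
    constructor <;> linarith
  refine ⟨fun N => ?_, fun t => ?_⟩
  · linarith [hsum N, (hlow N).2]
  · have h1 : 0 ≤ l * ‖x t - z t‖ ^ 2 := by positivity
    have h2 := (hlow t).1
    have h3 := hsum t
    have h4 := Finset.sum_nonneg fun i (_ : i ∈ Finset.range t) => hdec i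
    unfold prox2 at h2
    linarith

end Trajectory

/-! ### Taylor bounds and variational inequalities in Hilbert space. -/

section Analysis

variable {E : Type*} [NormedAddCommGroup E] [InnerProductSpace ℝ E] [CompleteSpace E]

/-- The Taylor remainder along the segment minus its quadratic bound has nonpositive derivative on
`[0, 1]`. -/
theorem sub_sub_inner_le_of_lipschitz_gradient {S : Set E} (hS : Convex ℝ S) {F : E → ℝ}
    {F' : E → E} {L : ℝ} (hF : ∀ x ∈ S, HasGradientAt F (F' x) x)
    (hL : ∀ x ∈ S, ∀ y ∈ S, ‖F' x - F' y‖ ≤ L * ‖x - y‖) {a b : E} (ha : a ∈ S) (hb : b ∈ S) :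
    F b - F a - ⟪F' a, b - a⟫ ≤ L / 2 * ‖b - a‖ ^ 2 := by
  set ψ : ℝ → ℝ := fun s => F (a + s • (b - a)) - s * ⟪F' a, b - a⟫
    - L / 2 * s ^ 2 * ‖b - a‖ ^ 2 with hψ
  have hmem : ∀ s ∈ Icc (0 : ℝ) 1, a + s • (b - a) ∈ S :=
    fun s hs => hS.add_smul_sub_mem ha hb hs
  have hd : ∀ s ∈ Icc (0 : ℝ) 1, HasDerivAt ψ
      (⟪F' (a + s • (b - a)), b - a⟫ - ⟪F' a, b - a⟫ - L * s * ‖b - a‖ ^ 2) s := by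
    intro s hs
    have h1 : HasDerivAt (fun s : ℝ => a + s • (b - a)) (b - a) s := by
      simpa using ((hasDerivAt_id s).smul_const (b - a)).const_add a
    have h2 := (hF _ (hmem s hs)).hasFDerivAt.comp_hasDerivAt s h1
    have h3 := (hasDerivAt_id s).mul_const ⟪F' a, b - a⟫
    have h4 := ((hasDerivAt_pow 2 s).const_mul (L / 2)).mul_const (‖b - a‖ ^ 2)
    refine ((h2.sub h3).sub h4).congr_deriv ?_
    rw [InnerProductSpace.toDual_apply_apply]
    push_cast
    ring
  have hanti : AntitoneOn ψ (Icc 0 1) := by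
    refine antitoneOn_of_deriv_nonpos (convex_Icc 0 1)
      (fun s hs => (hd s hs).continuousAt.continuousWithinAt)
      (fun s hs => (hd s (interior_subset hs)).differentiableAt.differentiableWithinAt)
      fun s hs => ?_
    have hs' : s ∈ Icc (0 : ℝ) 1 := interior_subset hs
    rw [(hd s hs').deriv, ← inner_sub_left]
    have h1 := real_inner_le_norm (F' (a + s • (b - a)) - F' a) (b - a)
    have h2 := hL _ (hmem s hs') a ha
    rw [add_sub_cancel_left, norm_smul, Real.norm_eq_abs, abs_of_nonneg hs'.1] at h2
    have h3 := mul_le_mul_of_nonneg_right h2 (norm_nonneg (b - a))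
    linarith
  have h := hanti (left_mem_Icc.2 zero_le_one) (right_mem_Icc.2 zero_le_one) zero_le_one
  simp only [hψ] at h
  simp at h
  linarith

theorem abs_taylor_le_of_lipschitz_gradient {S : Set E} (hS : Convex ℝ S) {F : E → ℝ}
    {F' : E → E} {L : ℝ} (hF : ∀ x ∈ S, HasGradientAt F (F' x) x)
    (hL : ∀ x ∈ S, ∀ y ∈ S, ‖F' x - F' y‖ ≤ L * ‖x - y‖) {a b : E} (ha : a ∈ S) (hb : b ∈ S) :
    |F b - F a - ⟪F' a, b - a⟫| ≤ L / 2 * ‖b - a‖ ^ 2 := by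
  have h1 := sub_sub_inner_le_of_lipschitz_gradient hS hF hL ha hb
  have h2 := sub_sub_inner_le_of_lipschitz_gradient hS (F := fun x => -F x)
    (F' := fun x => -F' x) (L := L)
    (fun x hx => by
      have := (hF x hx).hasFDerivAt.neg
      rw [hasGradientAt_iff_hasFDerivAt, map_neg]
      exact this)
    (fun x hx y hy => by
      rw [neg_sub_neg, norm_sub_rev]
      exact hL x hx y hy) ha hb
  rw [inner_neg_left] at h2
  exact abs_le.2 ⟨by linarith, h1⟩

omit [CompleteSpace E] in
/-- The obtuse angle criterion for a nearest point of a convex set. -/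
theorem inner_nonpos_of_nearest {S : Set E} (hS : Convex ℝ S) {v w : E} (hw : w ∈ S)
    (hmin : ∀ u ∈ S, ‖v - w‖ ≤ ‖v - u‖) {u : E} (hu : u ∈ S) : ⟪v - w, u - w⟫ ≤ 0 := by
  have h := quadratic_growth hS (q := fun _ => 0) (κ := 0) (p := 2) (z := v)
    (fun a _ b _ s _ _ => by simp) hw hu fun x hx => by
      have := pow_le_pow_left₀ (norm_nonneg _) (hmin x hx) 2
      rw [norm_sub_rev w v, norm_sub_rev x v]
      linarith
  have e : ‖u - v‖ ^ 2 = ‖w - v‖ ^ 2 + 2 * ⟪w - v, u - w⟫ + ‖u - w‖ ^ 2 := by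
    rw [show u - v = (w - v) + (u - w) by abel, norm_add_sq_real]
  rw [e] at h
  rw [← neg_sub w v, inner_neg_left]
  linarith

omit [CompleteSpace E] in
-- Test with the point at distance `C - ‖x‖` from `x` in direction `-v`: the normal cone is trivial
-- in the interior of the ball.
theorem eq_zero_of_variational_of_norm_lt {C : ℝ} {v x : E} (hx : ‖x‖ < C)
    (h : ∀ u : E, ‖u‖ ≤ C → 0 ≤ ⟪v, u - x⟫) : v = 0 := by
  by_contra hv
  have hv0 : 0 < ‖v‖ := norm_pos_iff.2 hv
  have hs : 0 < (C - ‖x‖) / ‖v‖ := div_pos (by linarith) hv0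
  have h1 := h (x - ((C - ‖x‖) / ‖v‖) • v) (by
    refine (norm_sub_le _ _).trans ?_
    rw [norm_smul, Real.norm_eq_abs, abs_of_pos hs, div_mul_cancel₀ _ hv0.ne']
    linarith)
  rw [sub_sub_cancel_left, inner_neg_right, inner_smul_right, real_inner_self_eq_norm_sq] at h1
  have : 0 < (C - ‖x‖) / ‖v‖ * ‖v‖ ^ 2 := by positivity
  linarith

end Analysis

/-! ### Weak convexity, proximal points and subgradients. -/

section Regularizer

variable {m : ℕ} {h : Vec m → EReal} {ζ : ℝ}

namespace IsRegularizer

variable (hh : IsRegularizer h ζ)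
include hh

theorem isCompact_edom : IsCompact (edom h) :=
  Metric.isCompact_of_isClosed_isBounded hh.isClosed_dom hh.bounded_dom

theorem convex_edom : Convex ℝ (edom h) := hh.weaklyConvex.1

theorem continuousOn_toReal : ContinuousOn (fun y => (h y).toReal) (edom h) :=
  hh.locallyLipschitz.continuousOn

theorem weaklyConvex_segment : ∀ a ∈ edom h, ∀ b ∈ edom h, ∀ s : ℝ, 0 ≤ s → s ≤ 1 →
    (h (a + s • (b - a))).toReal
      ≤ (1 - s) * (h a).toReal + s * (h b).toReal + ζ / 2 * (s * (1 - s)) * ‖b - a‖ ^ 2 := by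
  intro a ha b hb s hs0 hs1
  have h1 := hh.weaklyConvex.2 ha hb (sub_nonneg.2 hs1) hs0 (by ring)
  have e1 : (1 - s) • a + s • b = a + s • (b - a) := by module
  have e2 : ‖a + s • (b - a)‖ ^ 2 = ‖a‖ ^ 2 + 2 * s * ⟪a, b - a⟫ + s ^ 2 * ‖b - a‖ ^ 2 := by
    rw [norm_add_sq_real, inner_smul_right, norm_smul, mul_pow, Real.norm_eq_abs, sq_abs]
    ring
  have e3 : ‖b‖ ^ 2 = ‖a‖ ^ 2 + 2 * ⟪a, b - a⟫ + ‖b - a‖ ^ 2 := by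
    rw [← norm_add_sq_real, add_sub_cancel]
  simp only [e1, smul_eq_mul] at h1
  rw [e2, e3] at h1
  linarith

theorem exists_isProx (τ : ℝ) (v : Vec m) : ∃ y, IsProx h τ v y := by
  obtain ⟨y, hy, hmin⟩ := hh.isCompact_edom.exists_isMinOn hh.nonempty
    (f := fun w => τ * (h w).toReal + 1 / 2 * ‖w - v‖ ^ 2)
    ((continuousOn_const.mul hh.continuousOn_toReal).add (by fun_prop))
  exact ⟨y, hy, fun w hw => hmin hw⟩

/-- The two `τ⁻¹`-quadratic terms cancel, so the modulus is `ζ/2` whatever the size of `τ ζ`. -/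
theorem isProx_lower {τ : ℝ} (hτ : 0 < τ) {v y : Vec m} (hp : IsProx h τ v y) :
    ∀ w ∈ edom h, (h y).toReal + ⟪τ⁻¹ • (v - y), w - y⟫ - ζ / 2 * ‖w - y‖ ^ 2 ≤ (h w).toReal := by
  intro w hw
  have h1 := quadratic_growth hh.convex_edom (q := fun y => (h y).toReal) (p := τ⁻¹) (z := v)
    hh.weaklyConvex_segment hp.1 hw fun x hx => by
      have := mul_le_mul_of_nonneg_left (hp.2 x hx) (inv_nonneg.2 hτ.le)
      rw [mul_add, mul_add, inv_mul_cancel_left₀ hτ.ne', inv_mul_cancel_left₀ hτ.ne'] at this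
      linarith
  have e : ‖w - v‖ ^ 2 = ‖y - v‖ ^ 2 + 2 * ⟪y - v, w - y⟫ + ‖w - y‖ ^ 2 := by
    rw [show w - v = (y - v) + (w - y) by abel, norm_add_sq_real]
  rw [e] at h1
  rw [← neg_sub y v, smul_neg, inner_neg_left, inner_smul_left, conj_trivial]
  linarith

/-- A quadratic error is below `ε ‖w - y‖` near `y`, and off the domain `h` is infinite. -/
theorem mem_subdiff_of_quadratic {y s : Vec m} (hy : y ∈ edom h) {κ : ℝ}
    (hs : ∀ w ∈ edom h, (h y).toReal + ⟪s, w - y⟫ - κ * ‖w - y‖ ^ 2 ≤ (h w).toReal) :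
    s ∈ subdiff h y := by
  refine ⟨hy, fun ε hε => ?_⟩
  have hev : ∀ᶠ w in 𝓝 y, κ * ‖w - y‖ < ε := by
    have : Tendsto (fun w => κ * ‖w - y‖) (𝓝 y) (𝓝 (κ * ‖y - y‖)) :=
      (by fun_prop : Continuous fun w => κ * ‖w - y‖).tendsto y
    rw [sub_self, norm_zero, mul_zero] at this
    exact this.eventually_lt_const hε
  filter_upwards [hev] with w hw
  by_cases hwY : w ∈ edom h
  · rw [← EReal.coe_toReal (ne_of_lt hwY) (hh.ne_bot w), EReal.coe_le_coe_iff]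
    have h1 := hs w hwY
    have h2 := mul_le_mul_of_nonneg_right hw.le (norm_nonneg (w - y))
    linarith
  · have : h w = ⊤ := not_lt_top_iff.1 hwY
    rw [this]
    exact le_top

end IsRegularizer

theorem dualResidual_le {d r : ℕ} (f : Mat d r → Vec m → ℝ) {x : Mat d r} {y s : Vec m}
    (hs : s ∈ subdiff h y) : dualResidual f h x y ≤ ENNReal.ofReal ‖s - gradY f x y‖ := by
  refine (Metric.infEDist_le_edist_of_mem (mem_image_of_mem _ hs)).trans (le_of_eq ?_)
  rw [edist_zero_left, ofReal_norm, neg_add_eq_sub]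
  rfl

end Regularizer

/-! ### The penalized problem as an instance of the abstract game. -/

section Coupling

variable {d r m : ℕ} {f : Mat d r → Vec m → ℝ} {h : Vec m → EReal}
  {ζ μ C Lxx Lxy Lyx Lyy : ℝ}

theorem isCompact_normBall (d r : ℕ) (C : ℝ) : IsCompact (normBall d r C) := by
  have : normBall d r C = Metric.closedBall 0 C := by
    ext x
    simp [normBall]
  rw [this]
  exact isCompact_closedBall _ _

theorem convex_normBall (d r : ℕ) (C : ℝ) : Convex ℝ (normBall d r C) := by
  have : normBall d r C = Metric.closedBall 0 C := by
    ext x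
    simp [normBall]
  rw [this]
  exact convex_closedBall _ _

theorem isCompact_imageBall (d r : ℕ) (C : ℝ) : IsCompact (imageBall d r C) :=
  (isCompact_normBall d r C).image continuous_dissolve

theorem dissolve_mem_imageBall {x : Mat d r} (hx : x ∈ normBall d r C) :
    dissolve x ∈ imageBall d r C := mem_image_of_mem _ hx

theorem proj_mem_nearest {S : Set (Mat d r)} (hS : IsCompact S) (hne : S.Nonempty) (v : Mat d r) :
    proj S v ∈ nearest S v := by
  obtain ⟨w, hw, hmin⟩ := hS.exists_isMinOn hne (f := fun w => ‖v - w‖) (by fun_prop)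
  exact Classical.epsilon_spec (p := fun w => w ∈ nearest S v) ⟨w, hw, fun u hu => hmin hu⟩

theorem gradY_penalized (f : Mat d r → Vec m → ℝ) (ρ : ℝ) (x : Mat d r) (y : Vec m) :
    gradY (penalized f ρ) x y = gradY f (dissolve x) y := by
  unfold gradY gradient penalized
  rw [fderiv_add_const]

namespace IsSmoothCoupling

variable (hf : IsSmoothCoupling f h C Lxx Lxy Lyx Lyy)
include hf

theorem differentiableAt {x : Mat d r} {y : Vec m} (hx : x ∈ imageBall d r C) (hy : y ∈ edom h) :
    DifferentiableAt ℝ (fun q : Mat d r × Vec m => f q.1 q.2) (x, y) := by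
  obtain ⟨U, hU, hsub, hd⟩ := hf.differentiable
  exact hd.differentiableAt (hU.mem_nhds (hsub ⟨hx, hy⟩))

theorem differentiableAt_x {x : Mat d r} {y : Vec m} (hx : x ∈ imageBall d r C)
    (hy : y ∈ edom h) : DifferentiableAt ℝ (fun x' => f x' y) x :=
  DifferentiableAt.comp (f := fun x' => (x', y)) x (hf.differentiableAt hx hy) (by fun_prop)

theorem differentiableAt_y {x : Mat d r} {y : Vec m} (hx : x ∈ imageBall d r C)
    (hy : y ∈ edom h) : DifferentiableAt ℝ (f x) y :=
  DifferentiableAt.comp (f := fun y' => (x, y')) y (hf.differentiableAt hx hy) (by fun_prop)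

theorem hasGradientAt_x (ρ : ℝ) {x : Mat d r} {y : Vec m} (hx : x ∈ normBall d r C)
    (hy : y ∈ edom h) :
    HasGradientAt (fun x' => penalized f ρ x' y) (gradX (penalized f ρ) x y) x := by
  have h1 := hasGradientAt_penalized ρ (hf.differentiableAt_x (dissolve_mem_imageBall hx) hy)
  have h2 : gradX (penalized f ρ) x y = _ := h1.gradient
  rwa [h2]

theorem gradX_penalized (ρ : ℝ) {x : Mat d r} {y : Vec m} (hx : x ∈ normBall d r C)
    (hy : y ∈ edom h) : gradX (penalized f ρ) x y
      = gradDissolve x (gradX f (dissolve x) y) + (ρ / 2) • gradDefMap x (defMap x) :=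
  (hasGradientAt_penalized ρ (hf.differentiableAt_x (dissolve_mem_imageBall hx) hy)).gradient

theorem hasGradientAt_y (ρ : ℝ) {x : Mat d r} {y : Vec m} (hx : x ∈ normBall d r C)
    (hy : y ∈ edom h) : HasGradientAt (penalized f ρ x) (gradY (penalized f ρ) x y) y := by
  have h1 : DifferentiableAt ℝ (penalized f ρ x) y :=
    (hf.differentiableAt_y (dissolve_mem_imageBall hx) hy).add_const _
  exact h1.hasGradientAt

theorem continuousOn : ContinuousOn (fun q : Mat d r × Vec m => f q.1 q.2)
    (imageBall d r C ×ˢ edom h) :=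
  fun _ hq => (hf.differentiableAt hq.1 hq.2).continuousAt.continuousWithinAt

theorem exists_lower_bound (hh : IsRegularizer h ζ) :
    ∃ B : ℝ, ∀ x ∈ imageBall d r C, ∀ y ∈ edom h, -B ≤ f x y - (h y).toReal := by
  have hc : ContinuousOn (fun q : Mat d r × Vec m => f q.1 q.2 - (h q.2).toReal)
      (imageBall d r C ×ˢ edom h) :=
    hf.continuousOn.sub (hh.continuousOn_toReal.comp continuousOn_snd fun _ hq => hq.2)
  obtain ⟨b, hb⟩ := (((isCompact_imageBall d r C).prod hh.isCompact_edom).image_of_continuousOn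
    hc).bddBelow
  exact ⟨-b, fun x hx y hy => by
    rw [neg_neg]
    exact hb ⟨(x, y), ⟨hx, hy⟩, rfl⟩⟩

theorem continuousOn_gradX : ContinuousOn (fun q : Mat d r × Vec m => gradX f q.1 q.2)
    (imageBall d r C ×ˢ edom h) := by
  intro q hq
  have h1 : Tendsto (fun p : Mat d r × Vec m => Lxx * ‖p.1 - q.1‖ + Lxy * ‖p.2 - q.2‖)
      (𝓝[imageBall d r C ×ˢ edom h] q) (𝓝 0) := by
    have : Continuous fun p : Mat d r × Vec m => Lxx * ‖p.1 - q.1‖ + Lxy * ‖p.2 - q.2‖ := by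
      fun_prop
    simpa using (this.tendsto q).mono_left nhdsWithin_le_nhds
  refine tendsto_iff_norm_sub_tendsto_zero.2 (squeeze_zero' (.of_forall fun _ => norm_nonneg _)
    ?_ h1)
  filter_upwards [self_mem_nhdsWithin] with p hp
  exact hf.lipschitz_x _ hp.1 _ hq.1 _ hp.2 _ hq.2

theorem continuousOn_gradY : ContinuousOn (fun q : Mat d r × Vec m => gradY f q.1 q.2)
    (imageBall d r C ×ˢ edom h) := by
  intro q hq
  have h1 : Tendsto (fun p : Mat d r × Vec m => Lyx * ‖p.1 - q.1‖ + Lyy * ‖p.2 - q.2‖)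
      (𝓝[imageBall d r C ×ˢ edom h] q) (𝓝 0) := by
    have : Continuous fun p : Mat d r × Vec m => Lyx * ‖p.1 - q.1‖ + Lyy * ‖p.2 - q.2‖ := by
      fun_prop
    simpa using (this.tendsto q).mono_left nhdsWithin_le_nhds
  refine tendsto_iff_norm_sub_tendsto_zero.2 (squeeze_zero' (.of_forall fun _ => norm_nonneg _)
    ?_ h1)
  filter_upwards [self_mem_nhdsWithin] with p hp
  exact hf.lipschitz_y _ hp.1 _ hq.1 _ hp.2 _ hq.2

theorem exists_gradX_bound (hh : IsRegularizer h ζ) :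
    ∃ B : ℝ, 0 ≤ B ∧ ∀ x ∈ imageBall d r C, ∀ y ∈ edom h, ‖gradX f x y‖ ≤ B := by
  obtain ⟨B, hB⟩ := ((isCompact_imageBall d r C).prod hh.isCompact_edom).exists_bound_of_continuousOn
    hf.continuousOn_gradX
  exact ⟨max B 0, le_max_right _ _, fun x hx y hy => (hB (x, y) ⟨hx, hy⟩).trans (le_max_left _ _)⟩

theorem le_primal (hh : IsRegularizer h ζ) {x : Mat d r} (hx : x ∈ imageBall d r C) {w : Vec m}
    (hw : w ∈ edom h) : f x w - (h w).toReal ≤ primal f h x := by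
  have hc : ContinuousOn (fun y => f x y - (h y).toReal) (edom h) :=
    ContinuousOn.sub (fun y hy => (hf.differentiableAt_y hx hy).continuousAt.continuousWithinAt)
      hh.continuousOn_toReal
  exact le_csSup (hh.isCompact_edom.image_of_continuousOn hc).bddAbove (mem_image_of_mem _ hw)

theorem primalMin_le (hh : IsRegularizer h ζ) {x : Mat d r} (hx : x ∈ normBall d r C) :
    primalMin f h C ≤ primal f h (dissolve x) := by
  obtain ⟨B, hB⟩ := hf.exists_lower_bound hh
  obtain ⟨w, hw⟩ := hh.nonempty
  refine csInf_le ⟨-B, ?_⟩ (mem_image_of_mem _ hx)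
  rintro _ ⟨x, hx, rfl⟩
  exact (hB _ (dissolve_mem_imageBall hx) w hw).trans
    (hf.le_primal hh (dissolve_mem_imageBall hx) hw)

theorem isRegularGame (hh : IsRegularizer h ζ) (hpl : IsUniformlyPL f h C μ) {ρ l : ℝ}
    (hl : IsPenalizedLipschitz f h ρ C l) (hne : (normBall d r C).Nonempty) :
    IsRegularGame (normBall d r C) (edom h) (penalized f ρ) (gradX (penalized f ρ))
      (gradY (penalized f ρ)) (fun y => (h y).toReal) l ζ μ where
  l_pos := hl.1
  μ_pos := hpl.1
  ζ_nonneg := hh.modulus_nonneg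
  isCompact_X := isCompact_normBall d r C
  convex_X := convex_normBall d r C
  nonempty_X := hne
  isCompact_Y := hh.isCompact_edom
  convex_Y := hh.convex_edom
  nonempty_Y := hh.nonempty
  continuousOn := hh.continuousOn_toReal
  taylor_x := fun a ha b hb y hy =>
    abs_taylor_le_of_lipschitz_gradient (convex_normBall d r C)
      (F := fun x => penalized f ρ x y) (fun x hx => hf.hasGradientAt_x ρ hx hy)
      (fun x hx x' hx' => by simpa using (hl.2 x hx x' hx' y hy y hy).1) ha hb
  taylor_y := fun x hx a ha b hb =>
    abs_taylor_le_of_lipschitz_gradient hh.convex_edom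
      (fun y hy => hf.hasGradientAt_y ρ hx hy)
      (fun y hy y' hy' => by simpa using (hl.2 x hx x hx y hy y' hy').2) ha hb
  lipschitz_x := fun a ha b hb y hy w hw => (hl.2 a ha b hb y hy w hw).1
  lipschitz_y := fun a ha b hb y hy w hw => (hl.2 a ha b hb y hy w hw).2
  -- The penalty does not involve `y`, so it cancels in the value gap; the norm for one subgradient
  -- bounds the distance to all of them from above.
  pl := by
    intro x hx y hy s κ hs w hw
    have hx' := dissolve_mem_imageBall hx
    have h1 := hpl.2 _ hx' y hy
    have h2 := dualResidual_le f (x := dissolve x) (hh.mem_subdiff_of_quadratic hy hs)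
    have h3 := h1.trans (pow_le_pow_left' h2 2)
    rw [← ENNReal.ofReal_pow (norm_nonneg _), ENNReal.ofReal_le_ofReal_iff (sq_nonneg _)] at h3
    have h4 := hf.le_primal hh hx' hw
    rw [gradY_penalized]
    refine le_trans (mul_le_mul_of_nonneg_left ?_ (by linarith [hpl.1])) h3
    unfold penalized
    linarith

end IsSmoothCoupling

end Coupling

/-! ### Stationarity residual and counting of iterations. -/

section Residual

variable {E G : Type*} [NormedAddCommGroup E] [InnerProductSpace ℝ E]
  [NormedAddCommGroup G] [InnerProductSpace ℝ G]
  {X : Set E} {Y : Set G} {g : E → G → ℝ} {gx : E → G → E} {gy : E → G → G}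
  {η : G → ℝ} {l ζ μ : ℝ}

/-- The stationarity residual of one iteration. -/
noncomputable def residual (l ζ T : ℝ) (x : ℕ → E) (y : ℕ → G) (z : ℕ → E) (t : ℕ) : ℝ :=
  2 * T * ‖x (t + 1) - x t‖ + (48 * T + 16 * ζ) * ‖y (t + 1) - y t‖ + 2 * l * ‖x (t + 1) - z t‖

omit [InnerProductSpace ℝ E] [InnerProductSpace ℝ G] in
-- Cauchy–Schwarz on three terms; `32T`, `8R` with `R = 48T + 16ζ`, and `16l/β` are the ratios of
-- each squared summand to its share of `decrease`.
theorem residual_sq_le {T β : ℝ} (hT : 0 < T) (hζ : 0 ≤ ζ) (hl : 0 < l) (hβ : 0 < β)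
    (x : ℕ → E) (y : ℕ → G) (z : ℕ → E) (t : ℕ) :
    residual l ζ T x y z t ^ 2
      ≤ 3 * (32 * T + 8 * (48 * T + 16 * ζ) + 16 * l / β) * decrease l ζ T β x y z t := by
  unfold residual decrease
  set A := ‖x (t + 1) - x t‖
  set B := ‖y (t + 1) - y t‖
  set n := ‖x (t + 1) - z t‖
  set R := 48 * T + 16 * ζ
  have hR : 0 < R := by positivity
  set k := 16 * l / β with hk
  have hk0 : 0 < k := by positivity
  have hkβ : k * (l * β / 4 * n ^ 2) = 4 * l ^ 2 * n ^ 2 := by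
    rw [hk]
    field_simp
    ring
  have h1 : (2 * T * A + R * B + 2 * l * n) ^ 2
      ≤ 3 * ((2 * T * A) ^ 2 + (R * B) ^ 2 + (2 * l * n) ^ 2) := by
    nlinarith [sq_nonneg (2 * T * A - R * B), sq_nonneg (R * B - 2 * l * n),
      sq_nonneg (2 * T * A - 2 * l * n)]
  have p1 : 0 ≤ T / 8 * A ^ 2 := by positivity
  have p2 : 0 ≤ R / 8 * B ^ 2 := by positivity
  have p3 : 0 ≤ l * β / 4 * n ^ 2 := by positivity
  have q1 : 0 ≤ (8 * R + k) * (T / 8 * A ^ 2) := by positivity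
  have q2 : 0 ≤ (32 * T + k) * (R / 8 * B ^ 2) := by positivity
  have q3 : 0 ≤ (32 * T + 8 * R) * (l * β / 4 * n ^ 2) := by positivity
  nlinarith

theorem IsRegularGame.norm_gradient_le_residual (H : IsRegularGame X Y g gx gy η l ζ μ) {T β : ℝ}
    (hT : 3 * l ≤ T) {x : ℕ → E} {y : ℕ → G} {z : ℕ → E}
    (htr : IsTrajectory X Y gx gy η l ζ T β x y z) (t : ℕ)
    (h0 : gx (x t) (y t) + (2 * l) • (x t - z t) + T • (x (t + 1) - x t) = 0) :
    ‖gx (x (t + 1)) (y (t + 1))‖ ≤ residual l ζ T x y z t := by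
  have hl := H.l_pos
  have hζ := H.ζ_nonneg
  have e : gx (x (t + 1)) (y (t + 1)) = (gx (x (t + 1)) (y (t + 1)) - gx (x t) (y t))
      - (2 * l) • (x (t + 1) - z t) - (T - 2 * l) • (x (t + 1) - x t) := by
    have : gx (x t) (y t) = -((2 * l) • (x t - z t) + T • (x (t + 1) - x t)) :=
      eq_neg_of_add_eq_zero_left (by rw [← add_assoc]; exact h0)
    rw [this]
    module
  have h1 := H.lipschitz_x _ (htr.mem_X (t + 1)) _ (htr.mem_X t) _ (htr.mem_Y (t + 1)) _
    (htr.mem_Y t)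
  have h2 := norm_sub_le ((gx (x (t + 1)) (y (t + 1)) - gx (x t) (y t))
      - (2 * l) • (x (t + 1) - z t)) ((T - 2 * l) • (x (t + 1) - x t))
  have h3 := norm_sub_le (gx (x (t + 1)) (y (t + 1)) - gx (x t) (y t))
    ((2 * l) • (x (t + 1) - z t))
  rw [← e, norm_smul (T - 2 * l), Real.norm_eq_abs, abs_of_pos (by linarith)] at h2
  rw [norm_smul, Real.norm_eq_abs, abs_of_pos (by linarith)] at h3
  have h4 : l * ‖y (t + 1) - y t‖ ≤ (48 * T + 16 * ζ) * ‖y (t + 1) - y t‖ :=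
    mul_le_mul_of_nonneg_right (by linarith) (norm_nonneg _)
  have h5 : l * ‖x (t + 1) - x t‖ ≤ T * ‖x (t + 1) - x t‖ :=
    mul_le_mul_of_nonneg_right (by linarith) (norm_nonneg _)
  have h6 : 0 ≤ l * ‖x (t + 1) - x t‖ := by positivity
  unfold residual
  linarith

theorem tendsto_zero_of_sum_bounded {u : ℕ → ℝ} {c : ℝ} (hu : ∀ t, 0 ≤ u t)
    (hs : ∀ N, ∑ t ∈ Finset.range N, u t ≤ c) : Tendsto u atTop (𝓝 0) :=
  (summable_of_sum_range_le hu hs).tendsto_atTop_zero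

theorem exists_lt_of_sum_bounded {u : ℕ → ℝ} {c b : ℝ} (hb : 0 < b)
    (hs : ∀ N, ∑ t ∈ Finset.range N, u t ≤ c) (hc : 0 ≤ c) :
    ∃ t : ℕ, u t ≤ b ∧ (t : ℝ) + 1 ≤ c / b + 2 := by
  -- The extra index keeps the range nonempty when `c = 0`, as the strict sum comparison requires.
  set N := ⌈c / b⌉₊ + 1 with hN
  have h1 : ∃ t ∈ Finset.range N, u t ≤ b := by
    by_contra hcon
    push Not at hcon
    have h2 : ∑ _t ∈ Finset.range N, b < ∑ t ∈ Finset.range N, u t :=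
      Finset.sum_lt_sum_of_nonempty (by simp [hN]) hcon
    rw [Finset.sum_const, Finset.card_range, nsmul_eq_mul] at h2
    have h3 : c / b ≤ N := by
      rw [hN]
      push_cast
      linarith [Nat.le_ceil (c / b)]
    rw [div_le_iff₀ hb] at h3
    linarith [hs N]
  obtain ⟨t, ht, htb⟩ := h1
  refine ⟨t, htb, ?_⟩
  have h4 : (t : ℝ) + 1 ≤ N := by exact_mod_cast Finset.mem_range.1 ht
  have h5 : (N : ℝ) = ⌈c / b⌉₊ + 1 := by rw [hN]; push_cast; ring
  linarith [Nat.ceil_lt_add_one (div_nonneg hc hb.le)]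

end Residual

/-! ### The algorithm as a trajectory; passage to the manifold. -/

section Run

variable {d r m : ℕ} {f : Mat d r → Vec m → ℝ} {h : Vec m → EReal}
  {ζ μ C Lxx Lxy Lyx Lyy : ℝ}

theorem run_gradEvals (f : Mat d r → Vec m → ℝ) (h : Vec m → EReal) (P : Params) (x₀ : Mat d r)
    (y₀ : Vec m) (z₀ : Mat d r) (t : ℕ) : (run f h P x₀ y₀ z₀ t).gradEvals = 2 * t := by
  induction t with
  | zero => rfl
  | succ n ih =>
    change (run f h P x₀ y₀ z₀ n).gradEvals + 2 = _
    rw [ih]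
    ring

theorem proj_normBall_mem (hC : 0 ≤ C) (v : Mat d r) :
    proj (normBall d r C) v ∈ nearest (normBall d r C) v :=
  proj_mem_nearest (isCompact_normBall d r C) ⟨0, by simpa [normBall] using hC⟩ v

theorem run_isTrajectory (hh : IsRegularizer h ζ) (hf : IsSmoothCoupling f h C Lxx Lxy Lyx Lyy)
    (hC : 0 ≤ C) {α l τ₁ ρ : ℝ} (hτ : 0 < τ₁) {x₀ z₀ : Mat d r} {y₀ : Vec m}
    (hx₀ : x₀ ∈ normBall d r C) (hy₀ : y₀ ∈ edom h) :
    IsTrajectory (normBall d r C) (edom h) (gradX (penalized f ρ)) (gradY (penalized f ρ))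
      (fun y => (h y).toReal) l ζ τ₁⁻¹ (plParams ζ μ α l τ₁ ρ C).β
      (fun t => (run f h (plParams ζ μ α l τ₁ ρ C) x₀ y₀ z₀ t).x)
      (fun t => (run f h (plParams ζ μ α l τ₁ ρ C) x₀ y₀ z₀ t).y)
      (fun t => (run f h (plParams ζ μ α l τ₁ ρ C) x₀ y₀ z₀ t).z) := by
  set P := plParams ζ μ α l τ₁ ρ C with hP
  set s := run f h P x₀ y₀ z₀ with hs
  have hζ := hh.modulus_nonneg
  have hτ₂ : 0 < P.τ₂ := by
    change 0 < 1 / 16 * (3 / τ₁ + ζ)⁻¹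
    positivity
  have hτ₂i : P.τ₂⁻¹ = 48 * τ₁⁻¹ + 16 * ζ := by
    change (1 / 16 * (3 / τ₁ + ζ)⁻¹)⁻¹ = _
    rw [mul_inv, inv_inv]
    ring
  have hXs : ∀ t, (s (t + 1)).x ∈ nearest (normBall d r C) ((s t).x - τ₁ •
      (gradDissolve (s t).x (gradX f (dissolve (s t).x) (s t).y)
        + (ρ / 2) • gradDefMap (s t).x (defMap (s t).x) + (2 * l) • ((s t).x - (s t).z))) :=
    fun t => proj_normBall_mem hC _
  -- Only optimality of the chosen minimizer matters, not uniqueness. The vanishing multiple is the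
  -- damping `θ`, zero for these parameters.
  have hYs : ∀ t, IsProx h P.τ₂
      ((s t).y + P.τ₂ • (gradY f (dissolve (s (t + 1)).x) (s t).y - (0 : ℝ) • (s t).y))
      (s (t + 1)).y :=
    fun t => Classical.epsilon_spec (p := fun y => IsProx h P.τ₂ _ y) (hh.exists_isProx _ _)
  have hX : ∀ t, (s t).x ∈ normBall d r C := by
    rintro (_ | t)
    · exact hx₀
    · exact (hXs t).1
  have hY : ∀ t, (s t).y ∈ edom h := by
    rintro (_ | t)
    · exact hy₀
    · exact (hYs t).1
  refine ⟨hX, hY, fun t u hu => ?_, fun t w hw => ?_, fun t => rfl⟩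
  · have h1 := inner_nonpos_of_nearest (convex_normBall d r C) (hXs t).1 (hXs t).2 hu
    rw [← hf.gradX_penalized ρ (hX t) (hY t)] at h1
    have e : gradX (penalized f ρ) (s t).x (s t).y + (2 * l) • ((s t).x - (s t).z)
        + τ₁⁻¹ • ((s (t + 1)).x - (s t).x) = (-τ₁⁻¹) • ((s t).x - τ₁ •
          (gradX (penalized f ρ) (s t).x (s t).y + (2 * l) • ((s t).x - (s t).z))
            - (s (t + 1)).x) := by
      have : τ₁⁻¹ * τ₁ = 1 := inv_mul_cancel₀ hτ.ne'
      rw [sub_right_comm, smul_sub (-τ₁⁻¹), smul_smul (-τ₁⁻¹), neg_mul, this]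
      module
    rw [e, inner_smul_left, conj_trivial]
    exact mul_nonneg_of_nonpos_of_nonpos (by simpa using hτ.le) h1
  · have h1 := hh.isProx_lower hτ₂ (hYs t) w hw
    have e : P.τ₂⁻¹ • ((s t).y + P.τ₂ • (gradY f (dissolve (s (t + 1)).x) (s t).y
        - (0 : ℝ) • (s t).y) - (s (t + 1)).y)
        = gradY (penalized f ρ) (s (t + 1)).x (s t).y
          - (48 * τ₁⁻¹ + 16 * ζ) • ((s (t + 1)).y - (s t).y) := by
      rw [gradY_penalized, add_sub_right_comm, smul_add, smul_smul, inv_mul_cancel₀ hτ₂.ne', hτ₂i]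
      module
    rw [e] at h1
    exact h1

/-- This is where the slack `1/2` in the choice of `C` is spent. -/
theorem norm_lt_of_near_stiefel (hC : 1 / 2 + sSup ((fun x => ‖x‖) '' stiefel d r) < C)
    {x U : Mat d r} (hU : U ∈ stiefel d r) (hx : ‖x - U‖ ≤ 1 / 2) : ‖x‖ < C := by
  have h1 : ‖U‖ ≤ sSup ((fun x => ‖x‖) '' stiefel d r) := by
    refine le_csSup ⟨‖mone r‖, ?_⟩ (mem_image_of_mem _ hU)
    rintro _ ⟨W, hW, rfl⟩
    exact (norm_of_mem_stiefel hW).le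
  have h2 := norm_le_norm_sub_add x U
  linarith

/-- Feasible points with a small residual for the penalized problem are nearly stationary for the
problem on the Stiefel manifold. -/
theorem near_stationary (hf : IsSmoothCoupling f h C Lxx Lxy Lyx Lyy)
    (hC : 1 / 2 + sSup ((fun x => ‖x‖) '' stiefel d r) < C) {B : ℝ}
    (hB : ∀ x ∈ imageBall d r C, ∀ y ∈ edom h, ‖gradX f x y‖ ≤ B) {ρ δ : ℝ} (hρ₁ : 1 ≤ ρ)
    (hρ : 6 * (C * B) ≤ ρ) {x : Mat d r} {y s : Vec m} (hx : x ∈ normBall d r C) (hy : y ∈ edom h)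
    (hc : ‖defMap x‖ ≤ 1 / 2) (hgx : ‖gradX (penalized f ρ) x y‖ ≤ δ)
    (hgy : ‖s - gradY (penalized f ρ) x y‖ ≤ 2 * δ) :
    ∃ U ∈ stiefel d r, nearest (stiefel d r) x = {U} ∧ ρ * ‖x - U‖ ≤ 6 * δ ∧
      ‖riemGradX f U y‖ ≤ (10 + 6 * ((1 + C ^ 2) * (Lxx * (1 + C / 2)) + B / 2 + 2 * (C * B))) * δ ∧
      ‖s - gradY f U y‖ ≤ (2 + 6 * (Lyx * (1 + C / 2))) * δ := by
  obtain ⟨U, hU, hUn, hxU⟩ := nearest_stiefel_eq_singleton hc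
  have hxb : ‖x‖ ≤ C := hx
  have hC0 : 0 ≤ C := (norm_nonneg _).trans hxb
  have hUb : ‖U‖ ≤ C := (norm_lt_of_near_stiefel hC hU (by simp)).le
  -- `A` fixes the manifold pointwise, so the Lipschitz bounds on `X̄` apply at `U` itself.
  have hUi : U ∈ imageBall d r C := ⟨U, hUb, dissolve_of_mem_stiefel hU⟩
  have hxi := dissolve_mem_imageBall hx
  have hBx := hB _ hxi y hy
  have hB0 : 0 ≤ B := (norm_nonneg _).trans hBx
  have hδ : 0 ≤ δ := (norm_nonneg _).trans hgx
  rw [hf.gradX_penalized ρ hx hy] at hgx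
  rw [gradY_penalized] at hgy
  have h1 : ρ * ‖defMap x‖ ≤ 6 * δ :=
    (norm_defMap_le_of_penalized hc hxb hBx hρ).trans (by linarith)
  have h1' : ‖defMap x‖ ≤ 6 * δ := by nlinarith [norm_nonneg (defMap x)]
  have h2 := norm_dissolve_sub_le hxb hxU
  have h3 := norm_gradDissolve_sub_le (v := gradX f U y) hU hxb hUb hBx
  have h4 := hf.lipschitz_x _ hxi U hUi y hy y hy
  have h5 := hf.lipschitz_y _ hxi U hUi y hy y hy
  obtain ⟨hLxx, -, hLyx, -⟩ := hf.nonneg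
  rw [sub_self, norm_zero, mul_zero, add_zero] at h4 h5
  refine ⟨U, hU, hUn, (mul_le_mul_of_nonneg_left hxU (by linarith)).trans h1, ?_, ?_⟩
  · rw [riemGradX_eq_gradDissolve f y hU]
    set q := gradDissolve x (gradX f (dissolve x) y)
    set q' := gradDissolve U (gradX f U y)
    -- `ρ ‖x c(x)‖ ≤ 3/2 ρ ‖c(x)‖ ≤ 9δ`: the factor `ρ` is consumed, which keeps `K` free of `ρ`.
    have h6 : ‖(ρ / 2) • gradDefMap x (defMap x)‖ ≤ 9 * δ := by
      have := norm_mmul_defMap_le hc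
      rw [gradDefMap_eq, smul_smul, norm_smul, Real.norm_eq_abs, abs_of_nonneg (by linarith)]
      nlinarith
    have h7 : ‖q'‖ ≤ ‖q + (ρ / 2) • gradDefMap x (defMap x)‖
        + ‖(ρ / 2) • gradDefMap x (defMap x)‖ + ‖q - q'‖ := by
      have e : q' = (q + (ρ / 2) • gradDefMap x (defMap x)) - (ρ / 2) • gradDefMap x (defMap x)
          - (q - q') := by abel
      have k1 := norm_sub_le ((q + (ρ / 2) • gradDefMap x (defMap x))
        - (ρ / 2) • gradDefMap x (defMap x)) (q - q')
      have k2 := norm_sub_le (q + (ρ / 2) • gradDefMap x (defMap x))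
        ((ρ / 2) • gradDefMap x (defMap x))
      rw [← e] at k1
      linarith
    have h8 : ‖q - q'‖
        ≤ ((1 + C ^ 2) * (Lxx * (1 + C / 2)) + B / 2 + 2 * (C * B)) * ‖defMap x‖ := by
      have k1 : (1 + C ^ 2) * ‖gradX f (dissolve x) y - gradX f U y‖
          ≤ (1 + C ^ 2) * (Lxx * ((1 + C / 2) * ‖defMap x‖)) := by
        gcongr
        exact h4.trans (by gcongr)
      have k2 : 2 * (C * B) * ‖x - U‖ ≤ 2 * (C * B) * ‖defMap x‖ := by gcongr
      linarith
    have h9 : ((1 + C ^ 2) * (Lxx * (1 + C / 2)) + B / 2 + 2 * (C * B)) * ‖defMap x‖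
        ≤ ((1 + C ^ 2) * (Lxx * (1 + C / 2)) + B / 2 + 2 * (C * B)) * (6 * δ) := by gcongr
    linarith
  · have h6 := norm_add_le (s - gradY f (dissolve x) y) (gradY f (dissolve x) y - gradY f U y)
    rw [sub_add_sub_cancel] at h6
    have h7 : Lyx * ‖dissolve x - U‖ ≤ Lyx * ((1 + C / 2) * (6 * δ)) := by
      gcongr
      exact h2.trans (by gcongr)
    linarith

/-- Limits of nearly stationary points are stationary. -/
theorem isStationary_of_tendsto (hh : IsRegularizer h ζ)
    (hf : IsSmoothCoupling f h C Lxx Lxy Lyx Lyy)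
    (hC : 1 / 2 + sSup ((fun x => ‖x‖) '' stiefel d r) < C) {ι : Type*} {𝓕 : Filter ι} [𝓕.NeBot]
    {U : ι → Mat d r} {y s : ι → Vec m} {x' : Mat d r} {y' : Vec m}
    (hU : ∀ᶠ t in 𝓕, U t ∈ stiefel d r) (hy : ∀ᶠ t in 𝓕, y t ∈ edom h)
    (hs : ∀ᶠ t in 𝓕, ∀ w ∈ edom h,
      (h (y t)).toReal + ⟪s t, w - y t⟫ - ζ / 2 * ‖w - y t‖ ^ 2 ≤ (h w).toReal)
    (hUx : Tendsto U 𝓕 (𝓝 x')) (hyy : Tendsto y 𝓕 (𝓝 y'))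
    (hgx : Tendsto (fun t => riemGradX f (U t) (y t)) 𝓕 (𝓝 0))
    (hgy : Tendsto (fun t => s t - gradY f (U t) (y t)) 𝓕 (𝓝 0)) :
    IsStationary f h x' y' := by
  have himg : ∀ V ∈ stiefel d r, V ∈ imageBall d r C := fun V hV =>
    ⟨V, (norm_lt_of_near_stiefel hC hV (by simp)).le, dissolve_of_mem_stiefel hV⟩
  have hx' : x' ∈ stiefel d r := by
    have hcl : IsClosed (stiefel d r) := isClosed_eq continuous_defMap continuous_const
    exact hcl.mem_of_tendsto hUx hU
  have hy' : y' ∈ edom h := hh.isClosed_dom.mem_of_tendsto hyy hy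
  have hpair : Tendsto (fun t => (U t, y t)) 𝓕 (𝓝[imageBall d r C ×ˢ edom h] (x', y')) := by
    refine tendsto_nhdsWithin_iff.2 ⟨hUx.prodMk_nhds hyy, ?_⟩
    filter_upwards [hU, hy] with t h1 h2
    exact ⟨himg _ h1, h2⟩
  have hgX := (hf.continuousOn_gradX (x', y') ⟨himg _ hx', hy'⟩).tendsto.comp hpair
  have hgY := (hf.continuousOn_gradY (x', y') ⟨himg _ hx', hy'⟩).tendsto.comp hpair
  refine ⟨hx', hy', ?_, ?_⟩
  · rw [riemGradX_eq_gradDissolve f y' hx']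
    have h1 := (continuous_gradDissolve.tendsto (x', gradX f x' y')).comp (hUx.prodMk_nhds hgX)
    refine tendsto_nhds_unique (h1.congr' ?_) hgx
    filter_upwards [hU] with t ht
    exact (riemGradX_eq_gradDissolve f (y t) ht).symm
  · have hst : Tendsto s 𝓕 (𝓝 (gradY f x' y')) := by
      have := hgy.add hgY
      rw [zero_add] at this
      exact this.congr fun t => sub_add_cancel _ _
    have hη : Tendsto (fun t => (h (y t)).toReal) 𝓕 (𝓝 (h y').toReal) :=
      (hh.continuousOn_toReal y' hy').tendsto.comp (tendsto_nhdsWithin_iff.2 ⟨hyy, hy⟩)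
    -- The inequality has the same modulus `ζ/2` for every `t`, so it passes to the limit for each
    -- fixed `w`.
    refine ⟨gradY f x' y', hh.mem_subdiff_of_quadratic hy' (κ := ζ / 2) fun w hw => ?_,
      neg_add_cancel _⟩
    have h1 : Tendsto (fun t => (h (y t)).toReal + ⟪s t, w - y t⟫ - ζ / 2 * ‖w - y t‖ ^ 2) 𝓕
        (𝓝 ((h y').toReal + ⟪gradY f x' y', w - y'⟫ - ζ / 2 * ‖w - y'‖ ^ 2)) :=
      (hη.add (hst.inner (hyy.const_sub w))).sub (((hyy.const_sub w).norm.pow 2).const_mul _)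
    exact le_of_tendsto h1 (hs.mono fun t ht => ht w hw)

end Run

/-! ### Initial value, lower bound, feasibility and the condition number. -/

section Convergence

variable {d r m : ℕ} {f : Mat d r → Vec m → ℝ} {h : Vec m → EReal}
  {ζ μ C Lxx Lxy Lyx Lyy : ℝ}

theorem auxDual_eq_of_isInnerMin {ρ l : ℝ} {y : Vec m} {z a : Mat d r}
    (ha : IsInnerMin (normBall d r C) (penalized f ρ) l y z a) :
    auxDual f h ρ (2 * l) C y z = prox2 (penalized f ρ) l a y z - (h y).toReal := by
  have h1 : IsLeast ((fun x => smoothed f ρ (2 * l) x y z) '' normBall d r C)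
      (prox2 (penalized f ρ) l a y z) := by
    refine ⟨⟨a, ha.1, rfl⟩, ?_⟩
    rintro _ ⟨x, hx, rfl⟩
    exact ha.2 x hx
  rw [auxDual, h1.csInf_eq]

theorem penalized_of_mem_stiefel (ρ : ℝ) {z : Mat d r} (hz : z ∈ stiefel d r) (y : Vec m) :
    penalized f ρ z y = f z y := by
  rw [penalized, dissolve_of_mem_stiefel hz, show defMap z = 0 from hz]
  simp

theorem auxPrimal_self (ρ p : ℝ) {z : Mat d r} (hz : z ∈ stiefel d r) :
    auxPrimal f h ρ p z z = primal f h z := by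
  simp [auxPrimal, primal, smoothed, penalized_of_mem_stiefel ρ hz]

/-- Penalty and proximal term vanish at `z₀`, so `Φ(z₀; z₀) = F(z₀)`; a minimizer of `Φ(·; z₀)` can
only do better. -/
theorem initial_value_le (hh : IsRegularizer h ζ) (hf : IsSmoothCoupling f h C Lxx Lxy Lyx Lyy)
    {ρ l : ℝ} {x₀ z₀ : Mat d r} {y₀ : Vec m} (hz₀ : z₀ ∈ stiefel d r) (hz₀C : z₀ ∈ normBall d r C)
    (hy₀ : y₀ ∈ edom h) (hx₀ : x₀ = z₀ ∨ x₀ ∈ primalSol f h ρ (2 * l) C z₀) :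
    prox2 (penalized f ρ) l x₀ y₀ z₀ - (h y₀).toReal ≤ primal f h z₀ := by
  have key : ∀ x ∈ normBall d r C,
      prox2 (penalized f ρ) l x y₀ z₀ - (h y₀).toReal ≤ auxPrimal f h ρ (2 * l) x z₀ := by
    intro x hx
    refine le_csSup ?_ (mem_image_of_mem (fun y => smoothed f ρ (2 * l) x y z₀ - (h y).toReal) hy₀)
    have hx' := dissolve_mem_imageBall hx
    refine ⟨primal f h (dissolve x) + ρ / 4 * ‖defMap x‖ ^ 2 + 2 * l / 2 * ‖x - z₀‖ ^ 2, ?_⟩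
    rintro _ ⟨w, hw, rfl⟩
    have := hf.le_primal hh hx' hw
    simp only [smoothed, penalized]
    linarith
  rcases hx₀ with rfl | hx₀
  · exact (key _ hz₀C).trans (auxPrimal_self ρ _ hz₀).le
  · exact ((key _ hx₀.1).trans (hx₀.2 z₀ hz₀C)).trans (auxPrimal_self ρ _ hz₀).le

theorem primalMin_le_of_isMax (hh : IsRegularizer h ζ)
    (hf : IsSmoothCoupling f h C Lxx Lxy Lyx Lyy) {ρ : ℝ} (hρ : 0 ≤ ρ) {a : Mat d r} {v : Vec m}
    (ha : a ∈ normBall d r C) (hv : v ∈ edom h)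
    (hmax : ∀ w ∈ edom h,
      penalized f ρ a w - (h w).toReal ≤ penalized f ρ a v - (h v).toReal) :
    primalMin f h C ≤ penalized f ρ a v - (h v).toReal := by
  refine (hf.primalMin_le hh ha).trans ?_
  refine csSup_le ⟨_, mem_image_of_mem _ hv⟩ ?_
  rintro _ ⟨w, hw, rfl⟩
  have h1 := hmax w hw
  have h2 : 0 ≤ ρ / 4 * ‖defMap a‖ ^ 2 := by positivity
  simp only [penalized] at *
  linarith

/-- `ρ/4 ‖c(x)‖² ≤ D + B ≤ ρ/16`, where neither `D` nor `B` need depend on `ρ`. -/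
theorem norm_defMap_le_half {ρ B D : ℝ} (hρ : 0 < ρ) (hρD : 16 * (D + B) ≤ ρ) {x : Mat d r}
    {y : Vec m} (hB : -B ≤ f (dissolve x) y - (h y).toReal)
    (hD : penalized f ρ x y - (h y).toReal ≤ D) : ‖defMap x‖ ≤ 1 / 2 := by
  unfold penalized at hD
  have h1 : ρ * ‖defMap x‖ ^ 2 ≤ ρ * (1 / 2) ^ 2 := by linarith
  exact (pow_le_pow_iff_left₀ (norm_nonneg _) (by norm_num) two_ne_zero).1
    (le_of_mul_le_mul_left h1 hρ)

theorem residual_factor_le {α T μ l ζ β : ℝ} (hα₀ : 0 < α) (hα₁ : α < 1) (hT : 0 < T)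
    (hζ : 0 ≤ ζ) (hμ : 0 < μ) (hl : 0 < l) (hβ₀ : 0 < β)
    (hβ : β * (48 * T + 16 * ζ) = α * min μ l) :
    3 * (32 * T + 8 * (48 * T + 16 * ζ) + 16 * l / β) ≤ 4000 * max 1 (l / μ) * (T + ζ) / α := by
  -- With this identity `l/β` equals `κ (48T + 16ζ)/α`, so the condition number enters linearly.
  have hκ : l = max 1 (l / μ) * min μ l := by
    rcases le_total μ l with hc | hc
    · rw [min_eq_left hc, max_eq_right ((one_le_div hμ).2 hc), div_mul_cancel₀ _ hμ.ne']
    · rw [min_eq_right hc, max_eq_left ((div_le_one hμ).2 hc), one_mul]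
  have hmin : 0 < min μ l := lt_min hμ hl
  set κ := max 1 (l / μ) with hκdef
  have hκ1 : 1 ≤ κ := le_max_left _ _
  have h1 : l / β = κ * (48 * T + 16 * ζ) / α := by
    rw [div_eq_div_iff hβ₀.ne' hα₀.ne']
    calc l * α = κ * min μ l * α := by rw [← hκ]
      _ = κ * (α * min μ l) := by ring
      _ = _ := by rw [← hβ]; ring
  rw [le_div_iff₀ hα₀, mul_div_assoc, h1]
  have h2 : 3 * (32 * T + 8 * (48 * T + 16 * ζ) + 16 * (κ * (48 * T + 16 * ζ) / α)) * α
      = α * (1248 * T + 384 * ζ) + κ * (2304 * T + 768 * ζ) := by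
    field_simp
    ring
  rw [h2]
  have h3 : α * (1248 * T + 384 * ζ) ≤ κ * (1248 * T + 384 * ζ) :=
    mul_le_mul_of_nonneg_right (by linarith) (by positivity)
  have h4 : 0 ≤ κ * T := by positivity
  have h5 : 0 ≤ κ * ζ := by positivity
  linarith

end Convergence

end SmMGDA

/-! ### Assembly of the two claims. -/

open SmMGDA in
-- Common source of both claims: one null sequence `δ` controls all residuals at iterate `t + 1`.
-- The subgradient `s t` is kept with its quadratic inequality, which is stronger than membership in
-- `subdiff` and stable under limits.
theorem SmMGDA.convergence {α : ℝ} (hα₀ : 0 < α) (hα₁ : α < 1 / 2306) {d r m : ℕ}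
    {f : Mat d r → Vec m → ℝ} {h : Vec m → EReal} {ζ μ C Lxx Lxy Lyx Lyy : ℝ}
    (hh : IsRegularizer h ζ) (hC : 1 / 2 + sSup ((fun x => ‖x‖) '' stiefel d r) < C)
    (hf : IsSmoothCoupling f h C Lxx Lxy Lyx Lyy) (hpl : IsUniformlyPL f h C μ)
    {z₀ : Mat d r} (hz₀ : z₀ ∈ stiefel d r) :
    ∃ ρbar : ℝ, 0 < ρbar ∧ ∃ K : ℝ, 0 < K ∧ ∀ ρ : ℝ, ρbar ≤ ρ →
      ∀ l : ℝ, IsPenalizedLipschitz f h ρ C l → ∀ τ₁ : ℝ, 0 < τ₁ → τ₁ ≤ 1 / (3 * l) →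
      ∀ y₀ ∈ dualSol f h ρ (2 * l) C z₀,
      ∀ x₀ : Mat d r, (x₀ = z₀ ∨ x₀ ∈ primalSol f h ρ (2 * l) C z₀) →
      ∃ (δ : ℕ → ℝ) (U : ℕ → Mat d r) (s : ℕ → Vec m),
        Tendsto δ atTop (𝓝 0) ∧
        (∀ ε : ℝ, 0 < ε → ∃ t : ℕ, δ t ≤ ε / 2 ∧
          (t : ℝ) + 1 ≤ 16000 * max 1 (l / μ) * (1 / τ₁ + ζ) *
            (primal f h z₀ - primalMin f h C) / (α * ε ^ 2) + 2) ∧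
        ∀ t, (run f h (plParams ζ μ α l τ₁ ρ C) x₀ y₀ z₀ (t + 1)).x ∈ normBall d r C ∧
          (run f h (plParams ζ μ α l τ₁ ρ C) x₀ y₀ z₀ (t + 1)).y ∈ edom h ∧
          U t ∈ stiefel d r ∧
          nearest (stiefel d r) (run f h (plParams ζ μ α l τ₁ ρ C) x₀ y₀ z₀ (t + 1)).x = {U t} ∧
          ρ * ‖(run f h (plParams ζ μ α l τ₁ ρ C) x₀ y₀ z₀ (t + 1)).x - U t‖ ≤ 6 * δ t ∧
          ‖riemGradX f (U t) (run f h (plParams ζ μ α l τ₁ ρ C) x₀ y₀ z₀ (t + 1)).y‖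
            ≤ K * δ t ∧
          (∀ w ∈ edom h,
            (h (run f h (plParams ζ μ α l τ₁ ρ C) x₀ y₀ z₀ (t + 1)).y).toReal
              + inner ℝ (s t) (w - (run f h (plParams ζ μ α l τ₁ ρ C) x₀ y₀ z₀ (t + 1)).y)
              - ζ / 2 * ‖w - (run f h (plParams ζ μ α l τ₁ ρ C) x₀ y₀ z₀ (t + 1)).y‖ ^ 2
            ≤ (h w).toReal) ∧
          ‖s t - gradY f (U t) (run f h (plParams ζ μ α l τ₁ ρ C) x₀ y₀ z₀ (t + 1)).y‖
            ≤ K * δ t := by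
  obtain ⟨B, hB⟩ := hf.exists_lower_bound hh
  obtain ⟨Bg, hBg₀, hBg⟩ := hf.exists_gradX_bound hh
  have hz₀C : z₀ ∈ normBall d r C := (norm_lt_of_near_stiefel hC hz₀ (by simp)).le
  have hC0 : 0 ≤ C := (norm_nonneg z₀).trans hz₀C
  obtain ⟨hLxx, -, hLyx, -⟩ := hf.nonneg
  set K₁ := 10 + 6 * ((1 + C ^ 2) * (Lxx * (1 + C / 2)) + Bg / 2 + 2 * (C * Bg)) with hK₁
  set K₂ := 2 + 6 * (Lyx * (1 + C / 2)) with hK₂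
  have hK₁0 : 0 < K₁ := by positivity
  have hK₂0 : 0 < K₂ := by positivity
  -- The second entry lets the penalty dominate the gradient of `f`, the third forces feasibility.
  -- All constants come from compactness and do not see `ρ`, `l` or `τ₁`.
  refine ⟨max 1 (max (6 * (C * Bg)) (16 * (primal f h z₀ + B))),
    lt_max_of_lt_left one_pos, K₁ + K₂, by positivity, ?_⟩
  intro ρ hρ l hl τ₁ hτ₁ hτ₁l y₀ hy₀ x₀ hx₀
  have hρ1 : 1 ≤ ρ := (le_max_left _ _).trans hρ
  have hρ2 : 6 * (C * Bg) ≤ ρ := ((le_max_left _ _).trans (le_max_right _ _)).trans hρ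
  have hρ3 : 16 * (primal f h z₀ + B) ≤ ρ := ((le_max_right _ _).trans (le_max_right _ _)).trans hρ
  have H := hf.isRegularGame hh hpl hl ⟨z₀, hz₀C⟩
  have hl0 := hl.1
  have hμ0 := hpl.1
  have hζ := hh.modulus_nonneg
  set P := plParams ζ μ α l τ₁ ρ C with hP
  have hx₀C : x₀ ∈ normBall d r C := by
    rcases hx₀ with rfl | hx₀
    · exact hz₀C
    · exact hx₀.1
  have htr : IsTrajectory (normBall d r C) (edom h) (gradX (penalized f ρ))
      (gradY (penalized f ρ)) (fun y => (h y).toReal) l ζ τ₁⁻¹ P.β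
      (fun t => (run f h P x₀ y₀ z₀ t).x) (fun t => (run f h P x₀ y₀ z₀ t).y)
      (fun t => (run f h P x₀ y₀ z₀ t).z) := run_isTrajectory hh hf hC0 hτ₁ hx₀C hy₀.1
  set x : ℕ → Mat d r := fun t => (run f h P x₀ y₀ z₀ t).x with hx
  set y : ℕ → Vec m := fun t => (run f h P x₀ y₀ z₀ t).y with hy
  set z : ℕ → Mat d r := fun t => (run f h P x₀ y₀ z₀ t).z with hz
  have hT0 : 0 < τ₁⁻¹ := inv_pos.2 hτ₁
  have hT : 3 * l ≤ τ₁⁻¹ := by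
    rw [le_inv_comm₀ (by positivity) hτ₁]
    simpa using hτ₁l
  have hR : 0 < 48 * τ₁⁻¹ + 16 * ζ := by positivity
  have hβ : P.β * (48 * τ₁⁻¹ + 16 * ζ) = α * min μ l := by
    have h1 : P.β = α * min μ l * (48 * τ₁⁻¹ + 16 * ζ)⁻¹ := by
      change α * min μ l * (1 / 16 * (3 / τ₁ + ζ)⁻¹) = _
      rw [show 48 * τ₁⁻¹ + 16 * ζ = 16 * (3 / τ₁ + ζ) by ring, mul_inv]
      ring
    rw [h1, inv_mul_cancel_right₀ hR.ne']
  have hmin : 0 < min μ l := lt_min hμ0 hl0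
  have hβ0 : 0 < P.β := by
    by_contra hc
    push Not at hc
    nlinarith [mul_pos hα₀ hmin]
  obtain ⟨hsum, hval⟩ := H.sum_decrease_le hα₀ hα₁ hT hβ htr
    (fun a ha w hw b hb => by
      have h1 := hy₀.2 w hw
      have h2 : auxDual f h ρ (2 * l) C y₀ z₀ = _ := auxDual_eq_of_isInnerMin ha
      have h3 : auxDual f h ρ (2 * l) C w z₀ = _ := auxDual_eq_of_isInnerMin hb
      rwa [h2, h3] at h1)
    (fun a ha v hv hmax => primalMin_le_of_isMax hh hf (by linarith) ha hv hmax)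
    (initial_value_le hh hf hz₀ hz₀C hy₀.1 hx₀)
  change ∀ N, _ ≤ primal f h z₀ - primalMin f h C at hsum
  set Δ := primal f h z₀ - primalMin f h C with hΔ
  have hΔ0 : 0 ≤ Δ := by
    have := hsum 0
    rwa [Finset.sum_range_zero] at this
  set D := decrease l ζ τ₁⁻¹ P.β x y z with hD
  have hD0 : ∀ t, 0 ≤ D t := by
    intro t
    rw [hD]
    unfold decrease
    positivity
  have hfac := residual_factor_le hα₀ (by linarith) hT0 hζ hμ0 hl0 hβ0 hβ
  set M := 4000 * max 1 (l / μ) * (τ₁⁻¹ + ζ) / α with hM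
  have hM0 : 0 < M := by
    have : 0 < max 1 (l / μ) := lt_max_of_lt_left one_pos
    positivity
  set δ := residual l ζ τ₁⁻¹ x y z with hδ
  have hδ0 : ∀ t, 0 ≤ δ t := by
    intro t
    rw [hδ]
    unfold residual
    positivity
  have hδD : ∀ t, δ t ^ 2 ≤ M * D t := fun t =>
    (residual_sq_le hT0 hζ hl0 hβ0 x y z t).trans (mul_le_mul_of_nonneg_right hfac (hD0 t))
  have hfeas : ∀ t, ‖defMap (x t)‖ ≤ 1 / 2 := fun t =>
    norm_defMap_le_half (h := h) (y := y t) (by linarith) hρ3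
      (hB _ (dissolve_mem_imageBall (htr.mem_X t)) _ (htr.mem_Y t)) (hval t)
  have hnear : ∀ t, ‖x t‖ < C := by
    intro t
    obtain ⟨V, hV, -, hxV⟩ := nearest_stiefel_eq_singleton (hfeas t)
    exact norm_lt_of_near_stiefel hC hV (hxV.trans (hfeas t))
  set s : ℕ → Vec m := fun t => gradY (penalized f ρ) (x (t + 1)) (y t)
    - (48 * τ₁⁻¹ + 16 * ζ) • (y (t + 1) - y t) with hs
  have hgx : ∀ t, ‖gradX (penalized f ρ) (x (t + 1)) (y (t + 1))‖ ≤ δ t := fun t =>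
    H.norm_gradient_le_residual hT htr t (eq_zero_of_variational_of_norm_lt (hnear (t + 1))
      fun u hu => htr.variational t u hu)
  have hgy : ∀ t, ‖s t - gradY (penalized f ρ) (x (t + 1)) (y (t + 1))‖ ≤ 2 * δ t := by
    intro t
    have h1 := norm_sub_le (gradY (penalized f ρ) (x (t + 1)) (y t)
      - gradY (penalized f ρ) (x (t + 1)) (y (t + 1))) ((48 * τ₁⁻¹ + 16 * ζ) • (y (t + 1) - y t))
    have h2 := H.lipschitz_y _ (htr.mem_X (t + 1)) _ (htr.mem_X (t + 1)) _ (htr.mem_Y t) _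
      (htr.mem_Y (t + 1))
    rw [sub_self, norm_zero, mul_zero, zero_add, norm_sub_rev (y t)] at h2
    rw [norm_smul, Real.norm_eq_abs, abs_of_pos hR] at h1
    have h3 : l * ‖y (t + 1) - y t‖ ≤ (48 * τ₁⁻¹ + 16 * ζ) * ‖y (t + 1) - y t‖ :=
      mul_le_mul_of_nonneg_right (by linarith) (norm_nonneg _)
    have h4 : (48 * τ₁⁻¹ + 16 * ζ) * ‖y (t + 1) - y t‖ ≤ δ t := by
      have k1 : 0 ≤ 2 * τ₁⁻¹ * ‖x (t + 1) - x t‖ := by positivity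
      have k2 : 0 ≤ 2 * l * ‖x (t + 1) - z t‖ := by positivity
      rw [hδ]
      unfold residual
      linarith
    simp only [hs]
    rw [sub_right_comm]
    linarith
  choose U hU hUn hUx hUg hUs using fun t => near_stationary hf hC hBg hρ1 hρ2
    (htr.mem_X (t + 1)) (htr.mem_Y (t + 1)) (hfeas (t + 1)) (hgx t) (hgy t)
  refine ⟨δ, U, s, ?_, fun ε hε => ?_, fun t => ⟨htr.mem_X (t + 1), htr.mem_Y (t + 1), hU t, hUn t,
    hUx t, (hUg t).trans ?_, htr.prox t, (hUs t).trans ?_⟩⟩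
  · have h1 := (tendsto_zero_of_sum_bounded hD0 hsum).const_mul M
    rw [mul_zero] at h1
    have h2 := (squeeze_zero (fun t => sq_nonneg (δ t)) hδD h1).sqrt
    rw [Real.sqrt_zero] at h2
    exact h2.congr fun t => Real.sqrt_sq (hδ0 t)
  -- With `b = ε²/(4M)` the bound `δ² ≤ M D` gives `δ ≤ ε/2`, and `Δ/b = 4MΔ/ε²` turns `4000` into
  -- `16000`.
  · obtain ⟨t, ht, htb⟩ := exists_lt_of_sum_bounded (b := ε ^ 2 / (4 * M)) (by positivity) hsum hΔ0
    refine ⟨t, ?_, htb.trans (le_of_eq ?_)⟩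
    · refine (pow_le_pow_iff_left₀ (hδ0 t) (by positivity) two_ne_zero).1 ((hδD t).trans ?_)
      refine (mul_le_mul_of_nonneg_left ht hM0.le).trans (le_of_eq ?_)
      field_simp
      norm_num
    · rw [hM, one_div]
      field_simp
      ring
  · exact mul_le_mul_of_nonneg_right (by linarith) (hδ0 t)
  · exact mul_le_mul_of_nonneg_right (by linarith) (hδ0 t)

theorem mainTheorem1 (α : ℝ) (hα₀ : 0 < α) (hα₁ : α < 1 / 2306) :
    ∃ c : ℝ, 0 < c ∧
    ∀ (d r m : ℕ) (f : SmMGDA.Mat d r → SmMGDA.Vec m → ℝ) (h : SmMGDA.Vec m → EReal)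
      (ζ μ C Lxx Lxy Lyx Lyy : ℝ),
      SmMGDA.IsRegularizer h ζ →
      1 / 2 + sSup ((fun x => ‖x‖) '' SmMGDA.stiefel d r) < C →
      SmMGDA.IsSmoothCoupling f h C Lxx Lxy Lyx Lyy →
      SmMGDA.IsUniformlyPL f h C μ →
      ∀ z₀ ∈ SmMGDA.stiefel d r,
      ∃ ρbar : ℝ, 0 < ρbar ∧ ∃ K : ℝ, 0 < K ∧
      ∀ ρ : ℝ, ρbar ≤ ρ →
      ∀ l : ℝ, SmMGDA.IsPenalizedLipschitz f h ρ C l →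
      ∀ τ₁ : ℝ, 0 < τ₁ → τ₁ ≤ 1 / (3 * l) →
      ∀ y₀ ∈ SmMGDA.dualSol f h ρ (2 * l) C z₀,
      ∀ x₀ : SmMGDA.Mat d r, (x₀ = z₀ ∨ x₀ ∈ SmMGDA.primalSol f h ρ (2 * l) C z₀) →
      (∀ ε : ℝ, 0 < ε → ∃ t : ℕ, ∃ s : SmMGDA.State d r m,
        s = SmMGDA.run f h (SmMGDA.plParams ζ μ α l τ₁ ρ C) x₀ y₀ z₀ t ∧
        (s.gradEvals : ℝ) ≤ c * (1 + max 1 (l / μ) * (1 / τ₁ + ζ) *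
          (SmMGDA.primal f h z₀ - SmMGDA.primalMin f h C) / ε ^ 2) ∧
        s.x ∈ SmMGDA.normBall d r C ∧
        s.y ∈ SmMGDA.edom h ∧
        ∃ x' : SmMGDA.Mat d r, SmMGDA.nearest (SmMGDA.stiefel d r) s.x = {x'} ∧
          ‖s.x - x'‖ ≤ 3 / ρ * ε ∧
          ‖SmMGDA.riemGradX f x' s.y‖ ≤ K * ε ∧
          SmMGDA.dualResidual f h x' s.y ≤ ENNReal.ofReal (K * ε)) ∧
      (∀ (x' : SmMGDA.Mat d r) (y' : SmMGDA.Vec m),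
        MapClusterPt (x', y') Filter.atTop (fun t : ℕ =>
          ((SmMGDA.run f h (SmMGDA.plParams ζ μ α l τ₁ ρ C) x₀ y₀ z₀ t).x,
            (SmMGDA.run f h (SmMGDA.plParams ζ μ α l τ₁ ρ C) x₀ y₀ z₀ t).y)) →
        SmMGDA.IsStationary f h x' y') := by
  -- Two gradients per iteration double the bound `16000/α · (...) + 2` on `t + 1`.
  refine ⟨4 + 32000 / α, by positivity, ?_⟩
  intro d r m f h ζ μ C Lxx Lxy Lyx Lyy hh hC hf hpl z₀ hz₀
  obtain ⟨ρbar, hρbar, K, hK, H⟩ := SmMGDA.convergence hα₀ hα₁ hh hC hf hpl hz₀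
  refine ⟨ρbar, hρbar, K, hK, ?_⟩
  intro ρ hρ l hl τ₁ hτ₁ hτ₁l y₀ hy₀ x₀ hx₀
  obtain ⟨δ, U, s, hδ, hcount, hU⟩ := H ρ hρ l hl τ₁ hτ₁ hτ₁l y₀ hy₀ x₀ hx₀
  have hρ0 : 0 < ρ := hρbar.trans_le hρ
  refine ⟨fun ε hε => ?_, fun x' y' hcl => ?_⟩
  · obtain ⟨t, ht, htb⟩ := hcount ε hε
    obtain ⟨hX, hY, hUt, hUn, hUx, hUg, hsub, hUs⟩ := hU t
    have hKε : K * δ t ≤ K * ε := mul_le_mul_of_nonneg_left (by linarith) hK.le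
    refine ⟨t + 1, _, rfl, ?_, hX, hY, U t, hUn, ?_, hUg.trans hKε, ?_⟩
    · rw [SmMGDA.run_gradEvals]
      have hz₀C : z₀ ∈ SmMGDA.normBall d r C :=
        (SmMGDA.norm_lt_of_near_stiefel hC hz₀ (by simp)).le
      have hΔ := hf.primalMin_le hh hz₀C
      rw [SmMGDA.dissolve_of_mem_stiefel hz₀] at hΔ
      have hζ := hh.modulus_nonneg
      have hS : 0 ≤ max 1 (l / μ) * (1 / τ₁ + ζ) *
          (SmMGDA.primal f h z₀ - SmMGDA.primalMin f h C) / ε ^ 2 := by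
        have : 0 < max 1 (l / μ) := lt_max_of_lt_left one_pos
        have := sub_nonneg.2 hΔ
        positivity
      have e : 16000 * max 1 (l / μ) * (1 / τ₁ + ζ) *
            (SmMGDA.primal f h z₀ - SmMGDA.primalMin f h C) / (α * ε ^ 2)
          = 16000 / α * (max 1 (l / μ) * (1 / τ₁ + ζ) *
            (SmMGDA.primal f h z₀ - SmMGDA.primalMin f h C) / ε ^ 2) := by
        rw [div_mul_div_comm]
        ring
      rw [e] at htb
      have h1 : (32000 : ℝ) / α = 2 * (16000 / α) := by ring
      have h2 : 0 ≤ 16000 / α := by positivity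
      push_cast
      rw [h1]
      nlinarith
    · rw [div_mul_eq_mul_div, le_div_iff₀ hρ0]
      linarith
    · exact (SmMGDA.dualResidual_le f (hh.mem_subdiff_of_quadratic hY hsub)).trans
        (ENNReal.ofReal_le_ofReal (hUs.trans hKε))
  · obtain ⟨𝓤, h𝓤, hlim⟩ := mapClusterPt_iff_ultrafilter.1 hcl
    set R := SmMGDA.run f h (SmMGDA.plParams ζ μ α l τ₁ ρ C) x₀ y₀ z₀ with hR
    have hx : Tendsto (fun t => (R t).x) 𝓤 (𝓝 x') := (continuous_fst.tendsto _).comp hlim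
    have hy : Tendsto (fun t => (R t).y) 𝓤 (𝓝 y') := (continuous_snd.tendsto _).comp hlim
    -- The estimates concern iterate `t + 1`; truncated subtraction is harmless because the
    -- ultrafilter ignores `t = 0`.
    have hshift : ∀ᶠ t in (𝓤 : Filter ℕ), t - 1 + 1 = t :=
      h𝓤 ((eventually_ge_atTop 1).mono fun t ht => Nat.sub_add_cancel ht)
    have hδ' : Tendsto (fun t => δ (t - 1)) 𝓤 (𝓝 0) :=
      (hδ.comp (tendsto_sub_atTop_nat 1)).mono_left h𝓤
    have hKδ : Tendsto (fun t => K * δ (t - 1)) 𝓤 (𝓝 0) := by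
      simpa using hδ'.const_mul K
    have hxU : Tendsto (fun t => (R t).x - U (t - 1)) 𝓤 (𝓝 0) := by
      have h6 : Tendsto (fun t => 6 * δ (t - 1) / ρ) 𝓤 (𝓝 0) := by
        simpa using (hδ'.const_mul 6).div_const ρ
      refine squeeze_zero_norm' ?_ h6
      filter_upwards [hshift] with t ht
      have h1 := (hU (t - 1)).2.2.2.2.1
      rw [ht] at h1
      rw [le_div_iff₀ hρ0]
      linarith
    refine SmMGDA.isStationary_of_tendsto hh hf hC (𝓕 := (𝓤 : Filter ℕ))
      (U := fun t => U (t - 1)) (y := fun t => (R t).y) (s := fun t => s (t - 1))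
      (.of_forall fun t => (hU (t - 1)).2.2.1) ?_ ?_ ?_ hy ?_ ?_
    · filter_upwards [hshift] with t ht
      have h1 := (hU (t - 1)).2.1
      rwa [ht] at h1
    · filter_upwards [hshift] with t ht
      have h1 := (hU (t - 1)).2.2.2.2.2.2.1
      rwa [ht] at h1
    · have h1 := hx.sub hxU
      rw [sub_zero] at h1
      exact h1.congr fun t => sub_sub_cancel _ _
    · refine squeeze_zero_norm' ?_ hKδ
      filter_upwards [hshift] with t ht
      have h1 := (hU (t - 1)).2.2.2.2.2.1
      rwa [ht] at h1
    · refine squeeze_zero_norm' ?_ hKδ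
      filter_upwards [hshift] with t ht
      have h1 := (hU (t - 1)).2.2.2.2.2.2.2
      rwa [ht] at h1
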